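/- Let $d\in\mathbb N$ and let $h:\mathbb R^d\to\mathbb R$ be continuous and coercive, i.e. $h(\xi)\to+\infty$ as $|\xi|\to\infty$. Suppose that $h$ has a strict saddle point at $\xi_0\in\mathbb R^d$: there are two non-trivial orthogonal subspaces $P_1,P_2$ of $\mathbb R^d$, which together span $\mathbb R^d$, and $\eta>0$ such that, for all unit vectors $e\in P_1$ and $f\in P_2$ and all $\lambda\in[-\eta,\eta]\setminus\{0\}$, $$h(\xi_0+\lambda e)<h(\xi_0)<h(\xi_0+\lambda f).$$ Then there is a stationary ergodic random field $V$ on $\mathbb R^d$, that is, a probability space $(\Omega,\mathcal F,\mathbb P)$ with an ergodic action $(\tau_x)_{x\in\mathbb R^d}$ of $\mathbb R^d$ by measure preserving transformations and a function $V:\mathbb R^d\times\Omega\to\mathbb R$, measurable in $\omega$, with $V(x,\omega)=V(0,\tau_x\omega)$, such that every realization $V(\cdot,\omega)$ is $2$-Lipschitz with values in $[-1,1]$, and such that the following holds for almost every $\omega$. For every $\varepsilon>0$ the initial value problem $$u^\varepsilon_t+h(Du^\varepsilon)-V(\tfrac x\varepsilon,\omega)=0\ \text{ in }\ \mathbb R^d\times(0,\infty),\qquad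 u^\varepsilon(x,0)=\xi_0\cdot x,$$ has exactly one viscosity solution $u^\varepsilon$ in the class of continuous functions on $\mathbb R^d\times[0,\infty)$ for which $u^\varepsilon(x,t)-\xi_0\cdot x$ is bounded on $\mathbb R^d\times[0,T]$ for every $T>0$, and the problem does not homogenize: for every $t>0$, $$\liminf_{\varepsilon\to0^+}u^\varepsilon(0,t)<\limsup_{\varepsilon\to0^+}u^\varepsilon(0,t).$$ -/

import Mathlib

open Filter Topology MeasureTheory

noncomputable section

/-- `h` has a strict saddle point at `ξ₀`: there are two non-trivial orthogonal subspaces, together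
spanning the whole space, and `η > 0` such that `h < h ξ₀` on the punctured segments of half-length
`η` through `ξ₀` in the directions of the first one, and `h > h ξ₀` on those in the directions of
the second one. -/
def HasStrictSaddle {d : ℕ} (h : EuclideanSpace ℝ (Fin d) → ℝ)
    (ξ₀ : EuclideanSpace ℝ (Fin d)) : Prop :=
  ∃ P₁ P₂ : Submodule ℝ (EuclideanSpace ℝ (Fin d)),
    P₁ ≠ ⊥ ∧ P₂ ≠ ⊥ ∧ P₁ ⟂ P₂ ∧ P₁ ⊔ P₂ = ⊤ ∧
    ∃ η : ℝ, 0 < η ∧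
      ∀ e ∈ P₁, ∀ f ∈ P₂, ‖e‖ = 1 → ‖f‖ = 1 →
        (∀ s ∈ Set.Icc (-η) η \ {0}, h (ξ₀ + s • e) < h ξ₀) ∧
        (∀ s ∈ Set.Icc (-η) η \ {0}, h ξ₀ < h (ξ₀ + s • f))

/-- Coercivity: `h ξ → +∞` as `|ξ| → ∞`. -/
def IsCoerciveHamiltonian {d : ℕ} (h : EuclideanSpace ℝ (Fin d) → ℝ) : Prop :=
  Tendsto h (cocompact (EuclideanSpace ℝ (Fin d))) atTop

/-- Crandall-Lions viscosity subsolution of `u_t + H(Du, x) = 0` in `ℝᵈ × (0, ∞)`,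
through `C¹` test functions touching from above. Only the values of `u` at positive times matter. -/
def IsViscositySubsolution {d : ℕ}
    (H : EuclideanSpace ℝ (Fin d) → EuclideanSpace ℝ (Fin d) → ℝ)
    (u : EuclideanSpace ℝ (Fin d) → ℝ → ℝ) : Prop :=
  ∀ φ : EuclideanSpace ℝ (Fin d) × ℝ → ℝ, ContDiff ℝ 1 φ →
    ∀ (x : EuclideanSpace ℝ (Fin d)) (t : ℝ), 0 < t →
      IsLocalMax (fun z : EuclideanSpace ℝ (Fin d) × ℝ => u z.1 z.2 - φ z) (x, t) →
        deriv (fun s => φ (x, s)) t + H (gradient (fun y => φ (y, t)) x) x ≤ 0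

/-- Crandall-Lions viscosity supersolution of `u_t + H(Du, x) = 0` in `ℝᵈ × (0, ∞)`,
through `C¹` test functions touching from below. -/
def IsViscositySupersolution {d : ℕ}
    (H : EuclideanSpace ℝ (Fin d) → EuclideanSpace ℝ (Fin d) → ℝ)
    (u : EuclideanSpace ℝ (Fin d) → ℝ → ℝ) : Prop :=
  ∀ φ : EuclideanSpace ℝ (Fin d) × ℝ → ℝ, ContDiff ℝ 1 φ →
    ∀ (x : EuclideanSpace ℝ (Fin d)) (t : ℝ), 0 < t →
      IsLocalMin (fun z : EuclideanSpace ℝ (Fin d) × ℝ => u z.1 z.2 - φ z) (x, t) →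
        0 ≤ deriv (fun s => φ (x, s)) t + H (gradient (fun y => φ (y, t)) x) x

/-- `u` is a viscosity solution of the initial value problem `u_t + H(Du, x) = 0` in
`ℝᵈ × (0, ∞)`, `u(x, 0) = ξ₀ · x`, in the class of continuous functions on `ℝᵈ × [0, ∞)` that stay
at bounded distance from the initial datum on every strip `ℝᵈ × [0, T]` (this class contains all
functions that are uniformly continuous on these strips and have this initial datum). -/
structure IsViscositySolution {d : ℕ}
    (H : EuclideanSpace ℝ (Fin d) → EuclideanSpace ℝ (Fin d) → ℝ)
    (ξ₀ : EuclideanSpace ℝ (Fin d)) (u : EuclideanSpace ℝ (Fin d) → ℝ → ℝ) : Prop where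
  continuousOn : ContinuousOn (fun z : EuclideanSpace ℝ (Fin d) × ℝ => u z.1 z.2)
    (Set.univ ×ˢ Set.Ici 0)
  initial : ∀ x, u x 0 = inner ℝ ξ₀ x
  bounded : ∀ T : ℝ, ∃ C : ℝ, ∀ x, ∀ t ∈ Set.Icc 0 T, |u x t - inner ℝ ξ₀ x| ≤ C
  sub : IsViscositySubsolution H u
  super : IsViscositySupersolution H u

/-- `u` is the viscosity solution of the initial value problem: it is one, and at nonnegative times
it coincides with every other one. -/
def IsTheViscositySolution {d : ℕ}
    (H : EuclideanSpace ℝ (Fin d) → EuclideanSpace ℝ (Fin d) → ℝ)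
    (ξ₀ : EuclideanSpace ℝ (Fin d)) (u : EuclideanSpace ℝ (Fin d) → ℝ → ℝ) : Prop :=
  IsViscositySolution H ξ₀ u ∧
    ∀ v, IsViscositySolution H ξ₀ v → ∀ x, ∀ t : ℝ, 0 ≤ t → v x t = u x t

/-- `V` is a stationary ergodic random field on `ℝᵈ`: the group `ℝᵈ` acts on the probability space
`(Ω, P)` by measurable, measure preserving transformations `τ_x ω = x +ᵥ ω`, the action is ergodic,
and `V(x, ω) = V(0, τ_x ω)`. -/
structure IsStationaryErgodicField {d : ℕ} {Ω : Type*} [MeasurableSpace Ω]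
    [AddAction (EuclideanSpace ℝ (Fin d)) Ω] (P : Measure Ω)
    (V : EuclideanSpace ℝ (Fin d) → Ω → ℝ) : Prop where
  isProbabilityMeasure : IsProbabilityMeasure P
  measurable_vadd : ∀ x : EuclideanSpace ℝ (Fin d), Measurable (fun ω : Ω => x +ᵥ ω)
  ergodic : ErgodicVAdd (EuclideanSpace ℝ (Fin d)) Ω P
  measurable : ∀ x, Measurable (V x)
  stationary : ∀ x ω, V x ω = V 0 (x +ᵥ ω)

end

/-!
The field is built from families of parallel hyperplanes, one family for each `n`, orthogonal to `e`
for even `n` and to `f` for odd `n`, where `e` and `f` are unit vectors along which `h` has a strict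
maximum and a strict minimum at `ξ₀`. The spacings `scale n` grow very fast. The field is `δ`
on the hyperplanes of even index and `-δ` on those of odd index, and later families take precedence.
Its sample space is the closure of `ℝᵈ` in the infinite torus of the phases of these families, with
Haar measure. Translations by a dense subgroup of a compact group are ergodic
(`CharHull.ergodic`), and each phase is uniformly distributed. Hence, almost surely, for
infinitely many even `n` (and for infinitely many odd `n`) there is a hyperplane of the `n`-th family
at distance at most `κ * scale n` from the origin, for any fixed `κ > 0`
(`CharHull.ae_frequently_norm_coord_lt`), while by Borel-Cantelli the later families stay far
away from it (`PlaneField.ae_frequently_isolated_plane`).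

Suppose that `W ≥ -δ`, and that `W = δ` on a large piece of a hyperplane orthogonal to `e`. The roof
`⟨ξ₀, x⟩ - lam |⟨e, x⟩ - c| - σ ‖perp e x‖ + (δ / 2 - h ξ₀) t` is then a subsolution: off the hyperplane
its slope `lam` in the direction `e` lowers `h` by more than the deficit of `W`, and on the
hyperplane all its supergradients are, up to `σ`, in the segment through `ξ₀` in the direction `e`, on
which `h ≤ h ξ₀`. By comparison, the solution at the origin is at least `(δ / 4 - h ξ₀) t` at
time `t` if the hyperplane is close to the origin (`Viscosity.growth_of_hyperplane`). By the duality
`u ↦ -u`, it is at most `(-δ / 4 - h ξ₀) t` near a hyperplane of the other kind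
(`Viscosity.decay_of_hyperplane`). Along `ε = t / scale n`, with `n` even or odd, both occur.

Well-posedness rests on a comparison principle in which one of the two functions is Lipschitz in space
(`Viscosity.comparison`) and on Perron's method in a class of Lipschitz subsolutions. Time shifts
act on this class, so its supremum is Lipschitz in time. By coercivity, the test functions touching it
from below where it would fail to be a supersolution then have gradients in the interior of the
Lipschitz constraint, and there is room for a bump (`Viscosity.perronSup_super`).
-/

/-! ### The hull of a family of characters -/

/-- The hull of a homomorphism `χ` from a group into the infinite torus: the closure of its range.
It is a compact group on which the source of `χ` acts, through `χ`, by translations. -/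
abbrev CharHull {A : Type*} [AddCommGroup A] (χ : A →+ (ℕ → UnitAddCircle)) : Type :=
  χ.range.topologicalClosure

namespace CharHull

variable {A : Type*} [AddCommGroup A] (χ : A →+ (ℕ → UnitAddCircle))

/-- The homomorphism `χ` with values in its hull. -/
def embed : A →+ CharHull χ :=
  χ.codRestrict χ.range.topologicalClosure
    fun x => AddSubgroup.le_topologicalClosure _ ⟨x, rfl⟩

/-- The action on the hull by translations. -/
@[reducible] def addAction : AddAction A (CharHull χ) := AddAction.compHom _ (embed χ)

instance : CompactSpace (CharHull χ) :=
  isCompact_iff_compactSpace.1 (AddSubgroup.isClosed_topologicalClosure _).isCompact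

instance : SecondCountableTopology (CharHull χ) :=
  IsEmbedding.subtypeVal.secondCountableTopology

/-- The normalized Haar measure of the hull. -/
noncomputable def haar : Measure (CharHull χ) := Measure.addHaarMeasure ⊤

instance : (haar χ).IsAddHaarMeasure := by unfold haar; infer_instance

instance : IsProbabilityMeasure (haar χ) :=
  ⟨by simpa [haar] using Measure.addHaarMeasure_self (K₀ := (⊤ : TopologicalSpace.PositiveCompacts (CharHull χ)))⟩

theorem denseRange_embed : DenseRange (embed χ) := by
  intro ω
  rw [closure_subtype]
  have := ω.2
  have h2 : Subtype.val '' Set.range (embed χ) = (χ.range : Set (ℕ → UnitAddCircle)) := by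
    ext y; constructor
    · rintro ⟨_, ⟨x, rfl⟩, rfl⟩; exact ⟨x, rfl⟩
    · rintro ⟨x, rfl⟩; exact ⟨_, ⟨x, rfl⟩, rfl⟩
  rw [h2]
  exact this

theorem ergodic : letI := addAction χ; ErgodicVAdd A (CharHull χ) (haar χ) := by
  let := addAction χ
  have : AddAction.IsMinimal A (CharHull χ) := by
    constructor
    intro ω
    have : (AddAction.orbit A ω) = (fun y => y + ω) '' Set.range (embed χ) := by
      ext y; constructor
      · rintro ⟨x, rfl⟩; exact ⟨_, ⟨x, rfl⟩, rfl⟩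
      · rintro ⟨_, ⟨x, rfl⟩, rfl⟩; exact ⟨x, rfl⟩
    rw [this]
    exact ((Homeomorph.addRight ω).surjective.denseRange).dense_image
      (Homeomorph.addRight ω).continuous (denseRange_embed χ)
  have : VAddAssocClass A (CharHull χ) (CharHull χ) :=
    ⟨fun x ω ω' => add_assoc (embed χ x) ω ω'⟩
  have : MeasurableAdd₂ (CharHull χ) := inferInstance
  have : MeasurableNeg (CharHull χ) := inferInstance
  exact ErgodicVAdd.trans_isMinimal (haar χ) (CharHull χ)

/-- If the `n`-th character is onto, then the `n`-th coordinate is uniformly distributed. -/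
theorem haar_norm_coord_le {n : ℕ} (hn : Function.Surjective fun x => χ x n) (r : ℝ) :
    haar χ {ω | ‖ω.1 n‖ ≤ r} = ENNReal.ofReal (min 1 (2 * r)) := by
  let f : CharHull χ →+ UnitAddCircle :=
    (Pi.evalAddMonoidHom (fun _ : ℕ => UnitAddCircle) n).comp (AddSubgroup.subtype _)
  have hf : Continuous f := (continuous_apply n).comp continuous_subtype_val
  have hs : Function.Surjective f := fun y => by
    obtain ⟨x, rfl⟩ := hn y
    exact ⟨embed χ x, rfl⟩
  have := Measure.isAddHaarMeasure_map_of_isFiniteMeasure (haar χ) f hf hs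
  have : IsProbabilityMeasure (Measure.map f (haar χ)) :=
    Measure.isProbabilityMeasure_map hf.aemeasurable
  have : IsProbabilityMeasure (volume : Measure UnitAddCircle) :=
    ⟨by simp⟩
  have h1 : Measure.map f (haar χ) = volume :=
    Measure.isAddHaarMeasure_eq_of_isProbabilityMeasure _ _
  have h2 := AddCircle.volume_closedBall (T := (1:ℝ)) (x := 0) r
  rw [← h1, Measure.map_apply hf.measurable Metric.isClosed_closedBall.measurableSet] at h2
  rw [← h2]
  congr 1
  ext ω
  simp [f]

/-! ### Infinitely many near returns, and a Borel-Cantelli bound -/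

theorem measurable_norm_coord (n : ℕ) : Measurable fun ω : CharHull χ => ‖ω.1 n‖ :=
  (continuous_norm.comp ((continuous_apply n).comp continuous_subtype_val)).measurable

/-- If the characters along a subsequence `s` are onto and tend to `0` pointwise, then almost every
point of the hull has infinitely many coordinates along `s` that are close to `0`: this happens
with positive probability by uniformity of the coordinates, and the event is invariant. -/
theorem ae_frequently_norm_coord_lt (s : ℕ → ℕ)
    (hs : ∀ k, Function.Surjective fun x => χ x (s k))
    (h0 : ∀ x, Tendsto (fun k => ‖χ x (s k)‖) atTop (𝓝 0)) {κ : ℝ} (hκ : 0 < κ) :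
    ∀ᵐ ω ∂(haar χ), ∃ᶠ k in atTop, ‖ω.1 (s k)‖ < κ := by
  let := addAction χ
  have herg : ErgodicVAdd A (CharHull χ) (haar χ) := ergodic χ
  set S : ℕ → ℕ → Set (CharHull χ) := fun j k => {ω | ‖ω.1 (s k)‖ < κ / 2 + 1 / ((j : ℝ) + 1)}
    with hS
  set I : Set (CharHull χ) := ⋂ j, limsup (S j) atTop with hI
  have hImem : ∀ ω, ω ∈ I ↔ ∀ j : ℕ, ∃ᶠ k in atTop, ‖ω.1 (s k)‖ < κ / 2 + 1 / ((j : ℝ) + 1) := by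
    intro ω
    simp [hI, hS, mem_limsup_iff_frequently_mem]
  have hSm : ∀ j k, MeasurableSet (S j k) := fun j k =>
    measurableSet_lt (measurable_norm_coord χ (s k)) measurable_const
  have hIm : MeasurableSet I :=
    MeasurableSet.iInter fun j => MeasurableSet.measurableSet_limsup (hSm j)
  have hstep : ∀ (x : A) (ω : CharHull χ), ω ∈ I → x +ᵥ ω ∈ I := by
    intro x ω hω
    rw [hImem] at hω ⊢
    intro j
    have hpos : 0 < 1 / ((j : ℝ) + 1) - 1 / (((j + 1 : ℕ) : ℝ) + 1) := by
      rw [sub_pos]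
      apply one_div_lt_one_div_of_lt
      · positivity
      · push_cast; linarith
    refine ((hω (j + 1)).and_eventually ((h0 x).eventually_lt_const hpos)).mono ?_
    rintro k ⟨h1, h2⟩
    have h3 : (x +ᵥ ω).1 (s k) = χ x (s k) + ω.1 (s k) := rfl
    rw [h3]
    linarith [norm_add_le (χ x (s k)) (ω.1 (s k))]
  have hinv : ∀ x : A, (x +ᵥ ·) ⁻¹' I = I := by
    intro x
    ext ω
    refine ⟨fun h => ?_, hstep x ω⟩
    simpa using hstep (-x) _ h
  have hconst : EventuallyConst I (ae (haar χ)) :=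
    herg.aeconst_of_forall_preimage_vadd_ae_eq hIm fun x => by rw [hinv x]; exact .rfl
  have hpos : haar χ I ≠ 0 := by
    -- `I` contains the event that infinitely many coordinates have norm at most `κ / 2`
    set T : ℕ → Set (CharHull χ) := fun n => ⋃ k ≥ n, {ω | ‖ω.1 (s k)‖ ≤ κ / 2} with hT
    have hTm : ∀ n, MeasurableSet (T n) := fun n =>
      MeasurableSet.iUnion fun k => MeasurableSet.iUnion fun _ =>
        measurableSet_le (measurable_norm_coord χ (s k)) measurable_const
    have hTanti : Antitone T := by
      intro a b hab ω hω
      simp only [hT, Set.mem_iUnion] at hω ⊢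
      obtain ⟨k, hk, h⟩ := hω
      exact ⟨k, le_trans hab hk, h⟩
    have hlim := tendsto_measure_iInter_atTop (μ := haar χ)
      (fun n => (hTm n).nullMeasurableSet) hTanti ⟨0, measure_ne_top _ _⟩
    have hle : ENNReal.ofReal (min 1 κ) ≤ haar χ (⋂ n, T n) := by
      refine ge_of_tendsto' hlim fun n => ?_
      have := haar_norm_coord_le χ (hs n) (κ / 2)
      rw [mul_div_cancel₀ κ two_ne_zero] at this
      rw [← this]
      refine measure_mono fun ω hω => ?_
      simp only [hT, Set.mem_iUnion]
      exact ⟨n, le_rfl, hω⟩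
    have hsub : (⋂ n, T n) ⊆ I := by
      intro ω hω
      rw [hImem]
      intro j
      rw [frequently_atTop]
      intro n
      have := Set.mem_iInter.1 hω n
      simp only [hT, Set.mem_iUnion] at this
      obtain ⟨k, hk, h⟩ := this
      exact ⟨k, hk, lt_of_le_of_lt h (by simp; positivity)⟩
    have h1 : (0 : ENNReal) < ENNReal.ofReal (min 1 κ) :=
      ENNReal.ofReal_pos.2 (lt_min one_pos hκ)
    exact (lt_of_lt_of_le h1 (hle.trans (measure_mono hsub))).ne'
  have hae : ∀ᵐ ω ∂(haar χ), ω ∈ I := by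
    rcases eventuallyConst_set.1 hconst with h | h
    · exact h
    · exact absurd (measure_eq_zero_iff_ae_notMem.2 h) hpos
  filter_upwards [hae] with ω hω
  obtain ⟨j, hj⟩ := exists_nat_one_div_lt (half_pos hκ)
  exact ((hImem ω).1 hω j).mono fun k hk => by linarith

/-- Almost surely only finitely many coordinates are within `r n` of `0`, if `r` is summable. -/
theorem ae_eventually_lt_norm_coord (hs : ∀ n, Function.Surjective fun x => χ x n)
    {r : ℕ → ℝ} (hr0 : ∀ n, 0 ≤ r n) (hr : Summable r) :
    ∀ᵐ ω ∂(haar χ), ∀ᶠ n in atTop, r n < ‖ω.1 n‖ := by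
  have h : ∑' n, haar χ {ω | ‖ω.1 n‖ ≤ r n} ≠ ⊤ := by
    have h1 : ∀ n, haar χ {ω | ‖ω.1 n‖ ≤ r n} ≤ ENNReal.ofReal (2 * r n) := fun n => by
      rw [haar_norm_coord_le χ (hs n)]
      exact ENNReal.ofReal_le_ofReal (min_le_right _ _)
    refine ne_top_of_le_ne_top ?_ (ENNReal.tsum_le_tsum h1)
    rw [← ENNReal.ofReal_tsum_of_nonneg (fun n => by linarith [hr0 n]) (hr.mul_left 2)]
    exact ENNReal.ofReal_ne_top
  have := ae_eventually_notMem h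
  filter_upwards [this] with ω hω
  exact hω.mono fun n hn => by simpa using hn

end CharHull

/-! ### The random field -/

namespace PlaneField

/-- The spacings of the families of parallel hyperplanes. They grow so fast that a family is
unlikely to be seen on the scale of the preceding one. -/
noncomputable def scale : ℕ → ℝ
  | 0 => 1
  | n + 1 => 2 ^ (n + 1) * (1 + (n + 1) * scale n)

theorem one_le_scale (n : ℕ) : 1 ≤ scale n := by
  induction n with
  | zero => simp [scale]
  | succ n ih =>
    rw [scale]
    have h1 : (1 : ℝ) ≤ 2 ^ (n + 1) := one_le_pow₀ (by norm_num)
    have h2 : (1 : ℝ) ≤ 1 + (n + 1) * scale n := by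
      have : (0 : ℝ) ≤ (n + 1) * scale n := by positivity
      linarith
    nlinarith

theorem scale_pos (n : ℕ) : 0 < scale n := lt_of_lt_of_le one_pos (one_le_scale n)

theorem scale_mono : Monotone scale := by
  refine monotone_nat_of_le_succ fun n => ?_
  rw [scale]
  have h1 : (1 : ℝ) ≤ 2 ^ (n + 1) := one_le_pow₀ (by norm_num)
  have h3 := one_le_scale n
  have h2 : scale n ≤ 1 + (n + 1) * scale n := by
    have : (0 : ℝ) ≤ n * scale n := by positivity
    linarith
  nlinarith

theorem two_pow_le_scale (n : ℕ) : (2 : ℝ) ^ n ≤ scale n := by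
  cases n with
  | zero => simp [scale]
  | succ n =>
    rw [scale]
    have : (0 : ℝ) ≤ (n + 1) * scale n := by have := scale_pos n; positivity
    have h1 : (0 : ℝ) < 2 ^ (n + 1) := by positivity
    nlinarith

theorem tendsto_scale : Tendsto scale atTop atTop :=
  tendsto_atTop_mono two_pow_le_scale (tendsto_pow_atTop_atTop_of_one_lt one_lt_two)

section
variable {E : Type*} [NormedAddCommGroup E] [InnerProductSpace ℝ E]

/-- The direction orthogonal to the hyperplanes of the `n`-th family: `e` or `f`, according to the
parity of `n`. -/
def dir (e f : E) (n : ℕ) : E := if Even n then e else f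

/-- The phases of a point with respect to the families of hyperplanes: the `n`-th one is
`⟨dir n, x⟩ / scale n` modulo `1`. -/
noncomputable def phase (e f : E) : E →+ (ℕ → UnitAddCircle) where
  toFun x n := ((inner ℝ (dir e f n) x / scale n : ℝ) : UnitAddCircle)
  map_zero' := by ext n; simp
  map_add' x y := by ext n; simp [inner_add_right, add_div]

theorem phase_apply (e f x : E) (n : ℕ) :
    phase e f x n = ((inner ℝ (dir e f n) x / scale n : ℝ) : UnitAddCircle) := rfl

theorem norm_dir {F : Type*} [Norm F] {e f : F} (he : ‖e‖ = 1) (hf : ‖f‖ = 1) (n : ℕ) :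
    ‖dir e f n‖ = 1 := by
  unfold dir; split_ifs <;> assumption

theorem norm_coe_le_abs (y : ℝ) : ‖(y : UnitAddCircle)‖ ≤ |y| := by
  rw [UnitAddCircle.norm_eq]
  simpa using round_le y 0

theorem scale_mul_norm_phase_le {e f : E} (he : ‖e‖ = 1) (hf : ‖f‖ = 1) (x : E) (n : ℕ) :
    scale n * ‖phase e f x n‖ ≤ ‖x‖ := by
  have h1 : |inner ℝ (dir e f n) x| ≤ ‖x‖ := by
    simpa [norm_dir he hf] using abs_real_inner_le_norm (dir e f n) x
  have h2 := norm_coe_le_abs (inner ℝ (dir e f n) x / scale n)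
  rw [abs_div, abs_of_pos (scale_pos n), le_div_iff₀ (scale_pos n)] at h2
  rw [phase_apply]
  linarith

theorem surjective_phase {e f : E} (he : ‖e‖ = 1) (hf : ‖f‖ = 1) (n : ℕ) :
    Function.Surjective fun x => phase e f x n := by
  intro θ
  obtain ⟨y, rfl⟩ := QuotientAddGroup.mk_surjective θ
  refine ⟨(y * scale n) • dir e f n, ?_⟩
  have := (scale_pos n).ne'
  simp only [phase_apply, inner_smul_right, real_inner_self_eq_norm_sq, norm_dir he hf]
  congr 1
  field_simp

theorem tendsto_norm_phase {e f : E} (he : ‖e‖ = 1) (hf : ‖f‖ = 1) (x : E) :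
    Tendsto (fun n => ‖phase e f x n‖) atTop (𝓝 0) := by
  refine squeeze_zero (fun _ => norm_nonneg _) (fun n => ?_)
    (tendsto_const_nhds (x := ‖x‖).div_atTop tendsto_scale)
  rw [le_div_iff₀ (scale_pos n), mul_comm]
  exact scale_mul_norm_phase_le he hf x n

/-- The sample space: the hull of the phases. -/
abbrev Sample (e f : E) : Type := CharHull (phase e f)

noncomputable instance (e f : E) : AddAction E (Sample e f) := CharHull.addAction (phase e f)

theorem vadd_coord (e f : E) (x : E) (ω : Sample e f) (n : ℕ) :
    (x +ᵥ ω).1 n = phase e f x n + ω.1 n := rfl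

/-- The distance of the origin to the `n`-th family of hyperplanes. -/
noncomputable def planeDist {e f : E} (n : ℕ) (ω : Sample e f) : ℝ := scale n * ‖ω.1 n‖

/-- The field made of the first `n` families of hyperplanes, at the origin: families with even index
push the values up to `1`, those with odd index push them down to `-1`, and later families
take precedence over earlier ones. -/
noncomputable def approx {e f : E} : ℕ → Sample e f → ℝ
  | 0, _ => 0
  | n + 1, ω => if Even n then max (approx n ω) (1 - 2 * planeDist n ω)
      else min (approx n ω) (-1 + 2 * planeDist n ω)

/-- The field at the origin. The upper limit makes it defined at every sample point. -/
noncomputable def value {e f : E} (ω : Sample e f) : ℝ := limsup (fun n => approx n ω) atTop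

variable {e f : E}

theorem planeDist_nonneg (n : ℕ) (ω : Sample e f) : 0 ≤ planeDist n ω :=
  mul_nonneg (scale_pos n).le (norm_nonneg _)

theorem approx_mem (n : ℕ) (ω : Sample e f) : approx n ω ∈ Set.Icc (-1 : ℝ) 1 := by
  induction n with
  | zero => simp [approx]
  | succ n ih =>
    obtain ⟨h1, h2⟩ := ih
    have h3 := planeDist_nonneg n ω
    rw [approx]
    split_ifs
    · exact ⟨le_max_of_le_left h1, max_le h2 (by linarith)⟩
    · exact ⟨le_min h1 (by linarith), min_le_of_left_le h2⟩

theorem measurable_approx (n : ℕ) : Measurable (approx n : Sample e f → ℝ) := by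
  induction n with
  | zero => exact measurable_const
  | succ n ih =>
    have hq : Measurable (planeDist n : Sample e f → ℝ) :=
      (CharHull.measurable_norm_coord (phase e f) n).const_mul (scale n)
    by_cases hn : Even n
    · simp only [approx, hn, if_true]
      exact ih.max ((hq.const_mul 2).const_sub 1)
    · simp only [approx, hn, if_false]
      exact ih.min ((hq.const_mul 2).const_add (-1))

theorem measurable_value : Measurable (value : Sample e f → ℝ) :=
  Measurable.limsup measurable_approx

theorem isBoundedUnder_approx (ω : Sample e f) :
    IsBoundedUnder (· ≤ ·) atTop fun n => approx n ω :=
  isBoundedUnder_of ⟨1, fun n => (approx_mem n ω).2⟩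

theorem isCoboundedUnder_approx (ω : Sample e f) :
    IsCoboundedUnder (· ≤ ·) atTop fun n => approx n ω :=
  IsBoundedUnder.isCoboundedUnder_le (isBoundedUnder_of ⟨-1, fun n => (approx_mem n ω).1⟩)

theorem value_mem (ω : Sample e f) : value ω ∈ Set.Icc (-1 : ℝ) 1 := by
  constructor
  · exact le_limsup_of_frequently_le
      (Frequently.of_forall fun n => (approx_mem n ω).1) (isBoundedUnder_approx ω)
  · exact limsup_le_of_le (isCoboundedUnder_approx ω) (Eventually.of_forall fun n => (approx_mem n ω).2)

theorem abs_planeDist_vadd_sub_le (he : ‖e‖ = 1) (hf : ‖f‖ = 1) (n : ℕ) (x : E)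
    (ω : Sample e f) : |planeDist n (x +ᵥ ω) - planeDist n ω| ≤ ‖x‖ := by
  have h1 := abs_norm_sub_norm_le ((x +ᵥ ω).1 n) (ω.1 n)
  rw [vadd_coord, add_sub_cancel_right] at h1
  have h2 := scale_mul_norm_phase_le he hf x n
  have h3 : planeDist n (x +ᵥ ω) - planeDist n ω
      = scale n * (‖phase e f x n + ω.1 n‖ - ‖ω.1 n‖) := by
    rw [planeDist, planeDist, vadd_coord]; ring
  rw [h3, abs_mul, abs_of_pos (scale_pos n)]
  exact (mul_le_mul_of_nonneg_left h1 (scale_pos n).le).trans h2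

theorem abs_approx_vadd_sub_le (he : ‖e‖ = 1) (hf : ‖f‖ = 1) (n : ℕ) (x : E)
    (ω : Sample e f) : |approx n (x +ᵥ ω) - approx n ω| ≤ 2 * ‖x‖ := by
  induction n with
  | zero => simp [approx]
  | succ n ih =>
    have h1 := abs_planeDist_vadd_sub_le he hf n x ω
    rw [approx, approx]
    split_ifs
    · refine (abs_max_sub_max_le_max _ _ _ _).trans (max_le ih ?_)
      rw [abs_le] at h1 ⊢
      constructor <;> linarith
    · refine (abs_min_sub_min_le_max _ _ _ _).trans (max_le ih ?_)
      rw [abs_le] at h1 ⊢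
      constructor <;> linarith

theorem value_vadd_le (he : ‖e‖ = 1) (hf : ‖f‖ = 1) (x : E) (ω : Sample e f) :
    value (x +ᵥ ω) ≤ value ω + 2 * ‖x‖ := by
  rw [value, value, ← limsup_add_const _ _ _ (isBoundedUnder_approx ω) (isCoboundedUnder_approx ω)]
  refine limsup_le_limsup (Eventually.of_forall fun n => ?_) (isCoboundedUnder_approx _)
    (isBoundedUnder_of ⟨1 + 2 * ‖x‖, fun n => by linarith [(approx_mem n ω).2]⟩)
  have := (abs_le.1 (abs_approx_vadd_sub_le he hf n x ω)).2
  dsimp only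
  linarith

theorem abs_value_vadd_sub_le (he : ‖e‖ = 1) (hf : ‖f‖ = 1) (x y : E) (ω : Sample e f) :
    |value (x +ᵥ ω) - value (y +ᵥ ω)| ≤ 2 * ‖x - y‖ := by
  have h1 := value_vadd_le he hf (x - y) (y +ᵥ ω)
  have h2 := value_vadd_le he hf (y - x) (x +ᵥ ω)
  rw [vadd_vadd, sub_add_cancel] at h1 h2
  rw [norm_sub_rev] at h2
  rw [abs_le]
  constructor <;> linarith

/-- On a hyperplane of an even family which is not approached by a later odd family, the
field takes the value `1`. -/
theorem value_eq_one {n : ℕ} (hn : Even n) {ω : Sample e f} (h0 : planeDist n ω = 0)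
    (h : ∀ m, n < m → ¬ Even m → 1 ≤ planeDist m ω) : value ω = 1 := by
  have key : ∀ m, n < m → approx m ω = 1 := by
    intro m hm
    induction m, hm using Nat.le_induction with
    | base =>
      rw [approx, if_pos hn, h0]
      simpa using (approx_mem n ω).2
    | succ m hm ih =>
      rw [approx, ih]
      split_ifs with hem
      · have := planeDist_nonneg m ω
        exact max_eq_left (by linarith)
      · have := h m hm hem
        exact min_eq_left (by linarith)
  exact (tendsto_const_nhds.congr' ((eventually_gt_atTop n).mono fun m hm => (key m hm).symm)).limsup_eq

/-- On a hyperplane of an odd family which is not approached by a later even family, the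
field takes the value `-1`. -/
theorem value_eq_neg_one {n : ℕ} (hn : ¬ Even n) {ω : Sample e f} (h0 : planeDist n ω = 0)
    (h : ∀ m, n < m → Even m → 1 ≤ planeDist m ω) : value ω = -1 := by
  have key : ∀ m, n < m → approx m ω = -1 := by
    intro m hm
    induction m, hm using Nat.le_induction with
    | base =>
      rw [approx, if_neg hn, h0]
      simpa using (approx_mem n ω).1
    | succ m hm ih =>
      rw [approx, ih]
      split_ifs with hem
      · have := h m hm hem
        exact max_eq_left (by linarith)
      · have := planeDist_nonneg m ω
        exact min_eq_left (by linarith)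
  exact (tendsto_const_nhds.congr' ((eventually_gt_atTop n).mono fun m hm => (key m hm).symm)).limsup_eq

/-- Almost surely, infinitely many families along a subsequence `s` of indices have a hyperplane
at distance at most `κ * scale` from the origin which, in the ball of radius `K * scale`, is not
approached by any later family. -/
theorem ae_frequently_isolated_plane (he : ‖e‖ = 1) (hf : ‖f‖ = 1) {s : ℕ → ℕ}
    (hs : StrictMono s) {κ : ℝ} (hκ : 0 < κ) (K : ℝ) :
    ∀ᵐ ω ∂(CharHull.haar (phase e f)), ∃ᶠ k in atTop, ∃ c : ℝ, |c| ≤ κ * scale (s k) ∧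
      ∀ x : E, inner ℝ (dir e f (s k)) x = c → ‖x‖ ≤ K * scale (s k) →
        planeDist (s k) (x +ᵥ ω) = 0 ∧ ∀ m, s k < m → (1 : ℝ) ≤ planeDist m (x +ᵥ ω) := by
  have h1 := CharHull.ae_frequently_norm_coord_lt (phase e f) s
    (fun k => surjective_phase he hf (s k))
    (fun x => (tendsto_norm_phase he hf x).comp hs.tendsto_atTop) hκ
  -- the scales grow so fast that `(1 / 2) ^ n * scale n` exceeds any multiple of the earlier scales
  have h2 := CharHull.ae_eventually_lt_norm_coord (phase e f) (surjective_phase he hf)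
    (r := fun n => (1 / 2 : ℝ) ^ n) (fun n => by positivity)
    (summable_geometric_of_lt_one (by norm_num) (by norm_num))
  filter_upwards [h1, h2] with ω hω1 hω2
  obtain ⟨N, hN⟩ := eventually_atTop.1 hω2
  have hev : ∀ᶠ k in atTop, N ≤ s k ∧ K ≤ s k :=
    (hs.tendsto_atTop.eventually_ge_atTop N).and
      ((tendsto_natCast_atTop_atTop.comp hs.tendsto_atTop).eventually_ge_atTop K)
  refine (hω1.and_eventually hev).mono ?_
  rintro k ⟨hk, hkN, hkK⟩
  set n := s k
  obtain ⟨y₀, hy₀⟩ := QuotientAddGroup.mk_surjective (ω.1 n)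
  replace hy₀ : (y₀ : UnitAddCircle) = ω.1 n := hy₀
  -- the lift of the `n`-th coordinate which is nearest to `0`
  set y : ℝ := y₀ - round y₀ with hy
  have hyω : (y : UnitAddCircle) = ω.1 n := by
    rw [← hy₀, hy, AddCircle.coe_sub]
    have : ((round y₀ : ℝ) : UnitAddCircle) = 0 :=
      (AddCircle.coe_eq_zero_iff (1 : ℝ)).2 ⟨round y₀, by simp⟩
    rw [this, sub_zero]
  have hyn : |y| < κ := by
    rw [← hy₀, UnitAddCircle.norm_eq] at hk
    exact hk
  have hR := scale_pos n
  refine ⟨-(y * scale n), ?_, fun x hx hxn => ⟨?_, fun m hm => ?_⟩⟩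
  · rw [abs_neg, abs_mul, abs_of_pos hR]
    exact mul_le_mul_of_nonneg_right hyn.le hR.le
  · have : phase e f x n = -(y : UnitAddCircle) := by
      rw [phase_apply, hx, neg_div, mul_div_cancel_right₀ _ hR.ne', AddCircle.coe_neg]
    rw [planeDist, vadd_coord, this, hyω, neg_add_cancel, norm_zero, mul_zero]
  · have h3 := (abs_le.1 (abs_planeDist_vadd_sub_le he hf m x ω)).1
    have h4 := hN m (hkN.trans hm.le)
    obtain ⟨j, rfl⟩ : ∃ j, m = j + 1 := ⟨m - 1, by omega⟩
    have hnj : n ≤ j := by omega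
    have h5 : 1 + ((j : ℝ) + 1) * scale j ≤ planeDist (j + 1) ω := by
      rw [planeDist, scale]
      have h6 : (0 : ℝ) ≤ 1 + ((j : ℝ) + 1) * scale j := by have := scale_pos j; positivity
      calc 1 + ((j : ℝ) + 1) * scale j
          = 2 ^ (j + 1) * (1 + (j + 1) * scale j) * (1 / 2) ^ (j + 1) := by
            rw [mul_right_comm, ← mul_pow]; norm_num
        _ ≤ _ := mul_le_mul_of_nonneg_left h4.le (by positivity)
    have h7 : ‖x‖ ≤ ((j : ℝ) + 1) * scale j := by
      have h8 := scale_mono hnj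
      have h9 : (n : ℝ) ≤ j := by exact_mod_cast hnj
      have h10 := scale_pos j
      calc ‖x‖ ≤ K * scale n := hxn
        _ ≤ n * scale n := mul_le_mul_of_nonneg_right hkK hR.le
        _ ≤ (j + 1) * scale j := mul_le_mul (by linarith) h8 hR.le (by positivity)
    linarith

end

end PlaneField

/-! ### Test functions -/

namespace Viscosity

variable {d : ℕ}

local notation "𝔼" => EuclideanSpace ℝ (Fin d)

/-- The gradient in space of a function of space and time. -/
noncomputable def spaceGrad (φ : 𝔼 × ℝ → ℝ) (z : 𝔼 × ℝ) : 𝔼 :=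
  gradient (fun y => φ (y, z.2)) z.1

/-- The derivative in time of a function of space and time. -/
noncomputable def timeDeriv (φ : 𝔼 × ℝ → ℝ) (z : 𝔼 × ℝ) : ℝ :=
  deriv (fun s => φ (z.1, s)) z.2

theorem hasFDerivAt_slice_space {φ : 𝔼 × ℝ → ℝ} {z : 𝔼 × ℝ} (h : DifferentiableAt ℝ φ z) :
    HasFDerivAt (fun y => φ (y, z.2)) ((fderiv ℝ φ z).comp (ContinuousLinearMap.inl ℝ 𝔼 ℝ)) z.1 :=
  HasFDerivAt.comp (g := φ) z.1 h.hasFDerivAt (hasFDerivAt_prodMk_left z.1 z.2)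

theorem hasDerivAt_slice_time {φ : 𝔼 × ℝ → ℝ} {z : 𝔼 × ℝ} (h : DifferentiableAt ℝ φ z) :
    HasDerivAt (fun s => φ (z.1, s)) (fderiv ℝ φ z (0, 1)) z.2 := by
  have h2 : HasDerivAt (fun s : ℝ => (z.1, s)) ((0 : 𝔼), (1 : ℝ)) z.2 :=
    (hasDerivAt_const z.2 z.1).prodMk (hasDerivAt_id z.2)
  exact HasFDerivAt.comp_hasDerivAt (l := φ) z.2 h.hasFDerivAt h2

theorem spaceGrad_eq {φ : 𝔼 × ℝ → ℝ} {z : 𝔼 × ℝ} (h : DifferentiableAt ℝ φ z) :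
    spaceGrad φ z = (InnerProductSpace.toDual ℝ 𝔼).symm
      ((fderiv ℝ φ z).comp (ContinuousLinearMap.inl ℝ 𝔼 ℝ)) := by
  rw [spaceGrad, gradient, (hasFDerivAt_slice_space h).fderiv]

theorem timeDeriv_eq {φ : 𝔼 × ℝ → ℝ} {z : 𝔼 × ℝ} (h : DifferentiableAt ℝ φ z) :
    timeDeriv φ z = fderiv ℝ φ z (0, 1) := (hasDerivAt_slice_time h).deriv

theorem spaceGrad_add {φ ψ : 𝔼 × ℝ → ℝ} {z : 𝔼 × ℝ} (h : DifferentiableAt ℝ φ z)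
    (h' : DifferentiableAt ℝ ψ z) :
    spaceGrad (fun w => φ w + ψ w) z = spaceGrad φ z + spaceGrad ψ z := by
  rw [spaceGrad_eq h, spaceGrad_eq h', spaceGrad_eq (h.fun_add h'), ← map_add, fderiv_fun_add h h']
  rfl

theorem timeDeriv_add {φ ψ : 𝔼 × ℝ → ℝ} {z : 𝔼 × ℝ} (h : DifferentiableAt ℝ φ z)
    (h' : DifferentiableAt ℝ ψ z) :
    timeDeriv (fun w => φ w + ψ w) z = timeDeriv φ z + timeDeriv ψ z := by
  rw [timeDeriv_eq h, timeDeriv_eq h', timeDeriv_eq (h.fun_add h'), fderiv_fun_add h h']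
  rfl

theorem spaceGrad_neg (φ : 𝔼 × ℝ → ℝ) (z : 𝔼 × ℝ) :
    spaceGrad (fun w => -φ w) z = -spaceGrad φ z := by
  simp only [spaceGrad, gradient, fderiv_fun_neg, map_neg]

theorem timeDeriv_neg (φ : 𝔼 × ℝ → ℝ) (z : 𝔼 × ℝ) :
    timeDeriv (fun w => -φ w) z = -timeDeriv φ z := by
  simp only [timeDeriv, deriv.fun_neg]

theorem continuous_spaceGrad {φ : 𝔼 × ℝ → ℝ} (h : ContDiff ℝ 1 φ) :
    Continuous (spaceGrad φ) := by
  have h1 : spaceGrad φ = fun z => (InnerProductSpace.toDual ℝ 𝔼).symm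
      ((fderiv ℝ φ z).comp (ContinuousLinearMap.inl ℝ 𝔼 ℝ)) :=
    funext fun z => spaceGrad_eq (h.differentiable one_ne_zero z)
  rw [h1]
  exact (InnerProductSpace.toDual ℝ 𝔼).symm.continuous.comp
    ((h.continuous_fderiv one_ne_zero).clm_comp continuous_const)

theorem continuous_timeDeriv {φ : 𝔼 × ℝ → ℝ} (h : ContDiff ℝ 1 φ) :
    Continuous (timeDeriv φ) := by
  have h1 : timeDeriv φ = fun z => fderiv ℝ φ z (0, 1) :=
    funext fun z => timeDeriv_eq (h.differentiable one_ne_zero z)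
  rw [h1]
  exact (h.continuous_fderiv one_ne_zero).clm_apply continuous_const

theorem hasDerivAt_line {φ : 𝔼 × ℝ → ℝ} (h : ContDiff ℝ 1 φ) (x v : 𝔼) (t s : ℝ) :
    HasDerivAt (fun r : ℝ => φ (x + r • v, t + r * s))
      (inner ℝ (spaceGrad φ (x, t)) v + timeDeriv φ (x, t) * s) 0 := by
  have hd := h.differentiable one_ne_zero (x, t)
  have h1 : HasDerivAt (fun r : ℝ => (x + r • v, t + r * s)) (v, s) 0 := by
    have h2 : HasDerivAt (fun r : ℝ => x + r • v) v 0 := by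
      simpa using ((hasDerivAt_id (0 : ℝ)).smul_const v).const_add x
    have h3 : HasDerivAt (fun r : ℝ => t + r * s) s 0 := by
      simpa using ((hasDerivAt_id (0 : ℝ)).mul_const s).const_add t
    exact h2.prodMk h3
  have h4 : HasFDerivAt φ (fderiv ℝ φ (x, t)) (x + (0 : ℝ) • v, t + 0 * s) := by
    simpa using hd.hasFDerivAt
  have h5 := h4.comp_hasDerivAt (0 : ℝ) h1
  have h6 : fderiv ℝ φ (x, t) (v, s)
      = inner ℝ (spaceGrad φ (x, t)) v + timeDeriv φ (x, t) * s := by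
    rw [spaceGrad_eq hd, timeDeriv_eq hd, InnerProductSpace.toDual_symm_apply]
    have : ((v, s) : 𝔼 × ℝ) = (v, 0) + s • (0, 1) := by simp
    rw [this, map_add, map_smul]
    simp [mul_comm]
  rw [← h6]
  exact h5

/-- If `φ` touches `u` from above, then the derivative of `φ` in a direction is at least
any lower bound for the slope of `u` in this direction. -/
theorem le_deriv_of_isLocalMax {u : 𝔼 → ℝ → ℝ} {φ : 𝔼 × ℝ → ℝ} (hφ : ContDiff ℝ 1 φ)
    {x v : 𝔼} {t s c : ℝ} (hmax : IsLocalMax (fun z : 𝔼 × ℝ => u z.1 z.2 - φ z) (x, t))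
    (hc : ∀ᶠ r in 𝓝[>] (0 : ℝ), u x t + r * c ≤ u (x + r • v) (t + r * s)) :
    c ≤ inner ℝ (spaceGrad φ (x, t)) v + timeDeriv φ (x, t) * s := by
  have hd := hasDerivAt_line hφ x v t s
  have hlim : Tendsto _ (𝓝[>] (0 : ℝ)) _ := (hasDerivAt_iff_tendsto_slope_zero.1 hd).mono_left
    (nhdsWithin_mono (0 : ℝ) fun r (hr : 0 < r) => hr.ne')
  refine ge_of_tendsto hlim ?_
  have hcont : Tendsto (fun r : ℝ => (x + r • v, t + r * s)) (𝓝[>] 0) (𝓝 (x, t)) := by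
    have : Continuous fun r : ℝ => (x + r • v, t + r * s) := by fun_prop
    simpa using (this.tendsto 0).mono_left (nhdsWithin_le_nhds (s := Set.Ioi 0))
  filter_upwards [hc, hcont.eventually hmax, self_mem_nhdsWithin] with r h1 h2 (hr : 0 < r)
  simp only [zero_add, zero_smul, add_zero, zero_mul, smul_eq_mul] at h2 ⊢
  rw [inv_mul_eq_div, le_div_iff₀ hr]
  linarith

/-- Two `C¹` functions which touch have the same derivatives at the contact point. -/
theorem eq_of_isLocalMin {φ ψ : 𝔼 × ℝ → ℝ} {z : 𝔼 × ℝ} (hφ : ContDiff ℝ 1 φ)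
    (hψ : ContDiff ℝ 1 ψ) (h : IsLocalMin (fun w => φ w - ψ w) z) :
    spaceGrad φ z = spaceGrad ψ z ∧ timeDeriv φ z = timeDeriv ψ z := by
  have h1 := h.fderiv_eq_zero
  have h2 := hφ.differentiable one_ne_zero z
  have h3 := hψ.differentiable one_ne_zero z
  rw [fderiv_fun_sub h2 h3, sub_eq_zero] at h1
  rw [spaceGrad_eq h2, spaceGrad_eq h3, timeDeriv_eq h2, timeDeriv_eq h3, h1]
  exact ⟨rfl, rfl⟩

/-- A smooth substitute for the norm, used to confine maxima. -/
noncomputable def smoothNorm (x : 𝔼) : ℝ := √(1 + ‖x‖ ^ 2)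

theorem norm_le_smoothNorm (x : 𝔼) : ‖x‖ ≤ smoothNorm x :=
  Real.le_sqrt_of_sq_le (by linarith)

theorem smoothNorm_pos (x : 𝔼) : 0 < smoothNorm x := Real.sqrt_pos.2 (by positivity)

theorem contDiff_smoothNorm : ContDiff ℝ 1 (smoothNorm : 𝔼 → ℝ) :=
  ContDiff.sqrt (contDiff_const.add (contDiff_norm_sq ℝ)) fun x => by positivity

theorem hasFDerivAt_smoothNorm (x : 𝔼) :
    HasFDerivAt (smoothNorm : 𝔼 → ℝ) (innerSL ℝ ((smoothNorm x)⁻¹ • x)) x := by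
  have h1 : HasFDerivAt (fun y : 𝔼 => 1 + ‖y‖ ^ 2) (2 • innerSL ℝ x) x := by
    simpa using ((hasFDerivAt_id x).norm_sq).const_add 1
  have h2 := h1.sqrt (by positivity)
  refine HasFDerivAt.congr_fderiv h2 ?_
  ext v
  change 1 / (2 * smoothNorm x) * ((2 : ℕ) • inner ℝ x v) = inner ℝ ((smoothNorm x)⁻¹ • x) v
  have := (smoothNorm_pos x).ne'
  rw [inner_smul_left]
  simp
  field_simp

theorem norm_inv_smul_smoothNorm_le (x : 𝔼) : ‖(smoothNorm x)⁻¹ • x‖ ≤ 1 := by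
  have := smoothNorm_pos x
  rw [norm_smul, norm_inv, Real.norm_of_nonneg this.le, inv_mul_le_iff₀ this, mul_one]
  exact norm_le_smoothNorm x

/-- The test functions `A ‖x - a‖² + γ √(1 + ‖x‖²) + ⟨ξ, x⟩ + g(t)`. -/
noncomputable def testFun (A : ℝ) (a : 𝔼) (γ : ℝ) (ξ : 𝔼) (g : ℝ → ℝ) (z : 𝔼 × ℝ) : ℝ :=
  A * ‖z.1 - a‖ ^ 2 + γ * smoothNorm z.1 + inner ℝ ξ z.1 + g z.2

theorem contDiff_testFun (A : ℝ) (a : 𝔼) (γ : ℝ) (ξ : 𝔼) {g : ℝ → ℝ} (hg : ContDiff ℝ 1 g) :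
    ContDiff ℝ 1 (testFun A a γ ξ g) := by
  have h1 : ContDiff ℝ 1 fun z : 𝔼 × ℝ => ‖z.1 - a‖ ^ 2 :=
    (contDiff_fst.sub contDiff_const).norm_sq ℝ
  have h2 : ContDiff ℝ 1 fun z : 𝔼 × ℝ => smoothNorm z.1 := contDiff_smoothNorm.comp contDiff_fst
  have h3 : ContDiff ℝ 1 fun z : 𝔼 × ℝ => inner ℝ ξ z.1 := contDiff_const.inner ℝ contDiff_fst
  exact (((contDiff_const.mul h1).add (contDiff_const.mul h2)).add h3).add (hg.comp contDiff_snd)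

theorem timeDeriv_testFun (A : ℝ) (a : 𝔼) (γ : ℝ) (ξ : 𝔼) (g : ℝ → ℝ) (z : 𝔼 × ℝ) :
    timeDeriv (testFun A a γ ξ g) z = deriv g z.2 := by
  simp only [timeDeriv, testFun, deriv_const_add]

theorem spaceGrad_testFun (A : ℝ) (a : 𝔼) (γ : ℝ) (ξ : 𝔼) (g : ℝ → ℝ) (z : 𝔼 × ℝ) :
    spaceGrad (testFun A a γ ξ g) z
      = (2 * A) • (z.1 - a) + γ • (smoothNorm z.1)⁻¹ • z.1 + ξ := by
  refine HasGradientAt.gradient ?_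
  have h1 : HasFDerivAt (fun y : 𝔼 => ‖y - a‖ ^ 2) (2 • innerSL ℝ (z.1 - a)) z.1 := by
    simpa using ((hasFDerivAt_id z.1).sub_const a).norm_sq
  have h3 : HasFDerivAt (fun y : 𝔼 => inner ℝ ξ y) (innerSL ℝ ξ) z.1 :=
    (innerSL ℝ ξ).hasFDerivAt
  have h4 := (((h1.const_mul A).add ((hasFDerivAt_smoothNorm z.1).const_mul γ)).add h3).add_const
    (g z.2)
  rw [hasGradientAt_iff_hasFDerivAt]
  refine HasFDerivAt.congr_fderiv h4 ?_
  ext v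
  simp
  ring

/-! ### Viscosity sub- and supersolutions -/

/-- The change of unknown `u ↦ -u` exchanges sub- and supersolutions; the Hamiltonian `H(p, x)` becomes
`-H(-p, x)`, which turns a direction of maximum into one of minimum. -/
theorem super_neg {H : 𝔼 → 𝔼 → ℝ} {u : 𝔼 → ℝ → ℝ} (hu : IsViscositySubsolution H u) :
    IsViscositySupersolution (fun ξ x => -H (-ξ) x) (fun x t => -u x t) := by
  intro φ hφ x t ht hmin
  have := hu (fun w => -φ w) hφ.neg x t ht (by
    have := hmin.neg
    refine this.congr (Eventually.of_forall fun z => ?_)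
    dsimp only
    ring)
  change timeDeriv (fun w => -φ w) (x, t) + H (spaceGrad (fun w => -φ w) (x, t)) x ≤ 0 at this
  rw [timeDeriv_neg, spaceGrad_neg] at this
  change 0 ≤ timeDeriv φ (x, t) + -H (-spaceGrad φ (x, t)) x
  linarith

/-- The counterpart of `super_neg` for supersolutions. -/
theorem sub_neg {H : 𝔼 → 𝔼 → ℝ} {u : 𝔼 → ℝ → ℝ} (hu : IsViscositySupersolution H u) :
    IsViscositySubsolution (fun ξ x => -H (-ξ) x) (fun x t => -u x t) := by
  intro φ hφ x t ht hmax
  have := hu (fun w => -φ w) hφ.neg x t ht (by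
    have := hmax.neg
    refine this.congr (Eventually.of_forall fun z => ?_)
    dsimp only
    ring)
  change 0 ≤ timeDeriv (fun w => -φ w) (x, t) + H (spaceGrad (fun w => -φ w) (x, t)) x at this
  rw [timeDeriv_neg, spaceGrad_neg] at this
  change timeDeriv φ (x, t) + -H (-spaceGrad φ (x, t)) x ≤ 0
  linarith

theorem smoothNorm_le_add (x y : 𝔼) : smoothNorm x ≤ smoothNorm y + ‖x - y‖ := by
  have h1 := norm_le_smoothNorm y
  have h2 : smoothNorm y ^ 2 = 1 + ‖y‖ ^ 2 := Real.sq_sqrt (by positivity)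
  have h3 : ‖x‖ ≤ ‖y‖ + ‖x - y‖ := by
    simpa using norm_add_le y (x - y)
  have h4 := smoothNorm_pos y
  refine Real.sqrt_le_iff.2 ⟨by positivity, ?_⟩
  have h5 : ‖x‖ ^ 2 ≤ (‖y‖ + ‖x - y‖) ^ 2 := pow_le_pow_left₀ (norm_nonneg _) h3 2
  nlinarith [norm_nonneg (x - y)]

theorem sub_testFun_le {H : 𝔼 → 𝔼 → ℝ} {u : 𝔼 → ℝ → ℝ} (hu : IsViscositySubsolution H u)
    {A : ℝ} {a : 𝔼} {γ : ℝ} {ξ : 𝔼} {g : ℝ → ℝ} (hg : ContDiff ℝ 1 g) {x : 𝔼} {t : ℝ} (ht : 0 < t)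
    (hmax : IsLocalMax (fun z : 𝔼 × ℝ => u z.1 z.2 - testFun A a γ ξ g z) (x, t)) :
    deriv g t + H ((2 * A) • (x - a) + γ • (smoothNorm x)⁻¹ • x + ξ) x ≤ 0 := by
  have := hu _ (contDiff_testFun A a γ ξ hg) x t ht hmax
  change timeDeriv _ (x, t) + H (spaceGrad _ (x, t)) x ≤ 0 at this
  rwa [timeDeriv_testFun, spaceGrad_testFun] at this

theorem le_super_testFun {H : 𝔼 → 𝔼 → ℝ} {u : 𝔼 → ℝ → ℝ} (hu : IsViscositySupersolution H u)
    {A : ℝ} {a : 𝔼} {γ : ℝ} {ξ : 𝔼} {g : ℝ → ℝ} (hg : ContDiff ℝ 1 g) {x : 𝔼} {t : ℝ} (ht : 0 < t)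
    (hmin : IsLocalMin (fun z : 𝔼 × ℝ => u z.1 z.2 - testFun A a γ ξ g z) (x, t)) :
    0 ≤ deriv g t + H ((2 * A) • (x - a) + γ • (smoothNorm x)⁻¹ • x + ξ) x := by
  have := hu _ (contDiff_testFun A a γ ξ hg) x t ht hmin
  change 0 ≤ timeDeriv _ (x, t) + H (spaceGrad _ (x, t)) x at this
  rwa [timeDeriv_testFun, spaceGrad_testFun] at this

/-! ### A priori bounds -/

/-- A subsolution which stays at bounded distance from its affine initial datum `⟨ξ, x⟩` on strips
grows at most linearly in time. -/
theorem sub_le_of_bounded {h W : 𝔼 → ℝ} {ξ : 𝔼} {C : ℝ}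
    (hC : ∀ p, ‖p - ξ‖ ≤ 1 → |h p| + 1 ≤ C) (hW : ∀ x, W x ≤ 1) {u : 𝔼 → ℝ → ℝ}
    (hcont : ContinuousOn (fun z : 𝔼 × ℝ => u z.1 z.2) (Set.univ ×ˢ Set.Ici 0))
    (hinit : ∀ x, u x 0 = inner ℝ ξ x)
    (hbdd : ∀ T : ℝ, ∃ M : ℝ, ∀ x, ∀ t ∈ Set.Icc 0 T, u x t - inner ℝ ξ x ≤ M)
    (hu : IsViscositySubsolution (fun p x => h p - W x) u) (x₀ : 𝔼) {t₀ : ℝ} (ht₀ : 0 ≤ t₀) :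
    u x₀ t₀ ≤ inner ℝ ξ x₀ + C * t₀ := by
  by_contra! hlt
  obtain ⟨θ, hθ⟩ : ∃ θ, θ = u x₀ t₀ - inner ℝ ξ x₀ - C * t₀ := ⟨_, rfl⟩
  have hθ0 : 0 < θ := by linarith
  have hC0 : 0 ≤ C := by
    have := hC ξ (by simp)
    linarith [abs_nonneg (h ξ)]
  obtain ⟨M', hM'⟩ := hbdd (t₀ + 1)
  obtain ⟨M, hM0, hM⟩ : ∃ M, 0 < M ∧ ∀ x, ∀ t ∈ Set.Icc 0 (t₀ + 1), u x t - inner ℝ ξ x ≤ M :=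
    ⟨max M' 1, by positivity, fun x t ht => (hM' x t ht).trans (le_max_left _ _)⟩
  obtain ⟨ρ, hρ⟩ : ∃ ρ, ρ = θ / 3 := ⟨_, rfl⟩
  have hρ0 : 0 < ρ := by rw [hρ]; positivity
  obtain ⟨γ, hγ0, hγ1, hγ⟩ : ∃ γ, 0 < γ ∧ γ ≤ 1 ∧ γ * smoothNorm x₀ ≤ θ / 3 := by
    have hj := smoothNorm_pos x₀
    refine ⟨min 1 (θ / 3 / smoothNorm x₀), by positivity, min_le_left _ _, ?_⟩
    rw [← le_div_iff₀ hj]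
    exact min_le_right _ _
  obtain ⟨N, hN0, hN⟩ : ∃ N : ℝ, 0 < N ∧ M < ρ * Real.exp N := by
    refine ⟨M / ρ, by positivity, ?_⟩
    have := Real.add_one_le_exp (M / ρ)
    calc M = ρ * (M / ρ) := by field_simp
      _ < ρ * Real.exp (M / ρ) := mul_lt_mul_of_pos_left (by linarith) hρ0
  -- the exponential is negligible at time `t₀` and exceeds the bound `M` at time `t₀ + 1`
  set g : ℝ → ℝ := fun s => C * s + ρ * Real.exp (N * (s - t₀)) with hg
  have hgd : ContDiff ℝ 1 g := by
    simp only [hg]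
    fun_prop
  have hgderiv : ∀ s, deriv g s = C + ρ * (Real.exp (N * (s - t₀)) * N) := by
    intro s
    have h1 : HasDerivAt (fun s => N * (s - t₀)) N s := by
      simpa using ((hasDerivAt_id s).sub_const t₀).const_mul N
    have h2 : HasDerivAt (fun s => C * s) C s := by
      simpa using (hasDerivAt_id s).const_mul C
    exact (h2.add (h1.exp.const_mul ρ)).deriv
  set F : 𝔼 × ℝ → ℝ := fun z => u z.1 z.2 - testFun 0 0 γ ξ g z with hF
  have hFval : ∀ x t, F (x, t) = u x t - inner ℝ ξ x - γ * smoothNorm x - C * t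
      - ρ * Real.exp (N * (t - t₀)) := by
    intro x t
    simp only [hF, testFun, hg]
    ring
  set X : ℝ := max ‖x₀‖ (M / γ) with hX
  have hcomp : IsCompact (Metric.closedBall (0 : 𝔼) X ×ˢ Set.Icc (0 : ℝ) (t₀ + 1)) :=
    (isCompact_closedBall _ _).prod isCompact_Icc
  have hmem : (x₀, t₀) ∈ Metric.closedBall (0 : 𝔼) X ×ˢ Set.Icc (0 : ℝ) (t₀ + 1) :=
    ⟨by simp [hX], by constructor <;> linarith⟩
  have hFc : ContinuousOn F (Metric.closedBall (0 : 𝔼) X ×ˢ Set.Icc (0 : ℝ) (t₀ + 1)) :=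
    (hcont.mono fun z hz => ⟨trivial, hz.2.1⟩).sub
      (contDiff_testFun 0 0 γ ξ hgd).continuous.continuousOn
  obtain ⟨⟨x, t⟩, ⟨hx, ht⟩, hmax⟩ := hcomp.exists_isMaxOn ⟨_, hmem⟩ hFc
  have hpos : 0 < F (x, t) := by
    refine lt_of_lt_of_le ?_ (hmax hmem)
    rw [hFval, sub_self, mul_zero, Real.exp_zero]
    linarith
  rw [hFval] at hpos
  have hexp := Real.exp_pos (N * (t - t₀))
  have hj := norm_le_smoothNorm x
  have ht0 : 0 < t := by
    rcases ht.1.eq_or_lt with h0 | h0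
    · have h0' : t = 0 := h0.symm
      subst h0'
      have := smoothNorm_pos x
      rw [hinit] at hpos
      nlinarith
    · exact h0
  have hMx := hM x t ht
  have hCt : 0 ≤ C * t := by positivity
  have hγj : 0 ≤ γ * smoothNorm x := by have := smoothNorm_pos x; positivity
  have ht1 : t < t₀ + 1 := by
    rcases ht.2.eq_or_lt with h0 | h0
    · rw [show t - t₀ = 1 by linarith, mul_one] at hpos
      linarith
    · exact h0
  have hxX : ‖x‖ < X := by
    refine lt_of_lt_of_le ?_ (le_max_right _ _)
    rw [lt_div_iff₀ hγ0]
    nlinarith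
  have hnhds : Metric.closedBall (0 : 𝔼) X ×ˢ Set.Icc (0 : ℝ) (t₀ + 1) ∈ 𝓝 (x, t) :=
    prod_mem_nhds (Metric.closedBall_mem_nhds_of_mem (by simpa using hxX))
      (Icc_mem_nhds ht0 ht1)
  have hineq := sub_testFun_le hu hgd ht0 (hmax.isLocalMax hnhds)
  rw [hgderiv] at hineq
  have h1 := hC ((2 * 0 : ℝ) • (x - 0) + γ • (smoothNorm x)⁻¹ • x + ξ) (by
    rw [add_sub_cancel_right, mul_zero, zero_smul, zero_add, norm_smul, Real.norm_of_nonneg hγ0.le]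
    exact mul_le_one₀ hγ1 (norm_nonneg _) (norm_inv_smul_smoothNorm_le x))
  have h2 := neg_abs_le (h ((2 * 0 : ℝ) • (x - 0) + γ • (smoothNorm x)⁻¹ • x + ξ))
  have h3 := hW x
  have h4 : 0 < ρ * (Real.exp (N * (t - t₀)) * N) := by positivity
  linarith

/-- The counterpart of `sub_le_of_bounded` for supersolutions. -/
theorem le_super_of_bounded {h W : 𝔼 → ℝ} {ξ : 𝔼} {C : ℝ}
    (hC : ∀ p, ‖p - ξ‖ ≤ 1 → |h p| + 1 ≤ C) (hW : ∀ x, -1 ≤ W x) {u : 𝔼 → ℝ → ℝ}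
    (hcont : ContinuousOn (fun z : 𝔼 × ℝ => u z.1 z.2) (Set.univ ×ˢ Set.Ici 0))
    (hinit : ∀ x, u x 0 = inner ℝ ξ x)
    (hbdd : ∀ T : ℝ, ∃ M : ℝ, ∀ x, ∀ t ∈ Set.Icc 0 T, inner ℝ ξ x - u x t ≤ M)
    (hu : IsViscositySupersolution (fun p x => h p - W x) u) (x : 𝔼) {t : ℝ} (ht : 0 ≤ t) :
    inner ℝ ξ x - C * t ≤ u x t := by
  have key := sub_le_of_bounded (h := fun p => -h (-p)) (W := fun x => -W x) (ξ := -ξ) (C := C)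
    (u := fun x t => -u x t) (fun p hp => by
      rw [abs_neg]
      exact hC (-p) (by rwa [← norm_neg, neg_sub, sub_neg_eq_add, add_comm, ← sub_neg_eq_add]))
    (fun x => by linarith [hW x]) hcont.neg (fun x => by rw [hinit, inner_neg_left])
    (fun T => (hbdd T).imp fun M hM x t ht => by
      have := hM x t ht
      rw [inner_neg_left]; linarith)
    (by
      have := sub_neg hu
      have he : (fun (p x : 𝔼) => -(h (-p) - W x)) = fun p x => -h (-p) - -W x := by
        funext p x; ring
      rwa [he] at this) x ht
  rw [inner_neg_left] at key
  linarith

/-! ### The comparison principle -/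

/-- The function maximized in the method of doubling of variables. -/
noncomputable def doubled (u v : 𝔼 → ℝ → ℝ) (A γ ρ : ℝ) (x y : 𝔼) (t s : ℝ) : ℝ :=
  u x t - v y s - A * ‖x - y‖ ^ 2 - A * (t - s) ^ 2 - γ * smoothNorm x - ρ * (t + t ^ 2)

theorem exists_max_doubled {u v : 𝔼 → ℝ → ℝ} {ξ : 𝔼} {C A γ ρ : ℝ} (hA : 0 < A)
    (hγ : 0 < γ) (hρ : 0 < ρ) (hC : 0 ≤ C)
    (huc : ContinuousOn (fun z : 𝔼 × ℝ => u z.1 z.2) (Set.univ ×ˢ Set.Ici 0))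
    (hvc : ContinuousOn (fun z : 𝔼 × ℝ => v z.1 z.2) (Set.univ ×ˢ Set.Ici 0))
    (hu : ∀ x t, 0 ≤ t → u x t ≤ inner ℝ ξ x + C * t)
    (hv : ∀ x t, 0 ≤ t → inner ℝ ξ x - C * t ≤ v x t)
    {x₀ : 𝔼} {t₀ : ℝ} (ht₀ : 0 ≤ t₀) (hpos : 0 < doubled u v A γ ρ x₀ x₀ t₀ t₀) :
    ∃ x y t s, 0 ≤ t ∧ 0 ≤ s ∧ ∀ x' y' t' s', 0 ≤ t' → 0 ≤ s' →
      doubled u v A γ ρ x' y' t' s' ≤ doubled u v A γ ρ x y t s := by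
  set M : ℝ := ‖ξ‖ ^ 2 / (2 * A) + C ^ 2 / (2 * A) + 2 * C ^ 2 / ρ with hM
  have hM0 : 0 ≤ M := by positivity
  have bound : ∀ x y t s, 0 ≤ t → 0 ≤ s → 0 < doubled u v A γ ρ x y t s →
      ‖x‖ ≤ M / γ ∧ ‖x - y‖ ≤ 2 * M / A + 1 ∧ t ≤ 2 * M / ρ + 1 ∧ |t - s| ≤ 2 * M / A + 1 := by
    intro x y t s ht hs hp
    rw [doubled] at hp
    have h1 := hu x t ht
    have h2 := hv y s hs
    have h3 : inner ℝ ξ x - inner ℝ ξ y ≤ ‖ξ‖ * ‖x - y‖ := by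
      rw [← inner_sub_right]; exact real_inner_le_norm _ _
    have h4 := mul_le_mul_of_nonneg_left (norm_le_smoothNorm x) hγ.le
    have h5 : s ≤ t + |t - s| := by linarith [neg_abs_le (t - s)]
    have h6 : ‖ξ‖ * ‖x - y‖ ≤ A * ‖x - y‖ ^ 2 / 2 + ‖ξ‖ ^ 2 / (2 * A) := by
      have : A * ‖x - y‖ ^ 2 / 2 + ‖ξ‖ ^ 2 / (2 * A) - ‖ξ‖ * ‖x - y‖
          = (A * ‖x - y‖ - ‖ξ‖) ^ 2 / (2 * A) := by field_simp; ring
      have h0 : 0 ≤ (A * ‖x - y‖ - ‖ξ‖) ^ 2 / (2 * A) := by positivity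
      linarith
    have h7 : C * |t - s| ≤ A * |t - s| ^ 2 / 2 + C ^ 2 / (2 * A) := by
      have : A * |t - s| ^ 2 / 2 + C ^ 2 / (2 * A) - C * |t - s|
          = (A * |t - s| - C) ^ 2 / (2 * A) := by field_simp; ring
      have h0 : 0 ≤ (A * |t - s| - C) ^ 2 / (2 * A) := by positivity
      linarith
    have h8 : 2 * C * t ≤ ρ * t ^ 2 / 2 + 2 * C ^ 2 / ρ := by
      have : ρ * t ^ 2 / 2 + 2 * C ^ 2 / ρ - 2 * C * t
          = (ρ * t - 2 * C) ^ 2 / (2 * ρ) := by field_simp; ring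
      have h0 : 0 ≤ (ρ * t - 2 * C) ^ 2 / (2 * ρ) := by positivity
      linarith
    have h9 : C * s ≤ C * t + C * |t - s| := by nlinarith
    have h10 : (t - s) ^ 2 = |t - s| ^ 2 := (sq_abs _).symm
    rw [h10] at hp
    have h11 : A * ‖x - y‖ ^ 2 / 2 + A * |t - s| ^ 2 / 2 + ρ * t ^ 2 / 2 + γ * ‖x‖ ≤ M := by
      have : 0 ≤ ρ * t := by positivity
      rw [hM]; nlinarith
    have e1 : 0 ≤ A * ‖x - y‖ ^ 2 := by positivity
    have e2 : 0 ≤ A * |t - s| ^ 2 := by positivity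
    have e3 : 0 ≤ ρ * t ^ 2 := by positivity
    have e4 : 0 ≤ γ * ‖x‖ := by positivity
    have key : ∀ {B r : ℝ}, 0 < B → B * r ^ 2 / 2 ≤ M → r ≤ 2 * M / B + 1 := by
      intro B r hB hr
      have : r ^ 2 ≤ 2 * M / B := by rw [le_div_iff₀ hB]; linarith
      nlinarith [sq_nonneg (r - 1)]
    refine ⟨?_, key hA (by linarith), key hρ (by linarith), key hA (by linarith)⟩
    rw [le_div_iff₀ hγ]; linarith
  set X : ℝ := M / γ + (2 * M / A + 1) with hX
  set T : ℝ := 2 * M / ρ + 1 + (2 * M / A + 1) with hT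
  set S : Set (𝔼 × 𝔼 × ℝ × ℝ) := Metric.closedBall (0 : 𝔼) X ×ˢ Metric.closedBall (0 : 𝔼) X ×ˢ
    Set.Icc (0 : ℝ) T ×ˢ Set.Icc (0 : ℝ) T with hS
  have hSc : IsCompact S := (isCompact_closedBall _ _).prod
    ((isCompact_closedBall _ _).prod (isCompact_Icc.prod isCompact_Icc))
  have hSmem : ∀ x y t s, 0 ≤ t → 0 ≤ s → 0 < doubled u v A γ ρ x y t s → (x, y, t, s) ∈ S := by
    intro x y t s ht hs hp
    obtain ⟨h1, h2, h3, h4⟩ := bound x y t s ht hs hp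
    have hMA : 0 ≤ 2 * M / A := by positivity
    refine ⟨?_, ?_, ⟨ht, by linarith⟩, ⟨hs, ?_⟩⟩
    · rw [mem_closedBall_zero_iff]; linarith
    · rw [mem_closedBall_zero_iff]
      have : ‖y‖ ≤ ‖x‖ + ‖x - y‖ := by simpa using norm_sub_le x (x - y)
      linarith
    · change s ≤ T
      linarith [neg_abs_le (t - s)]
  have hcont : ContinuousOn
      (fun w : 𝔼 × 𝔼 × ℝ × ℝ => doubled u v A γ ρ w.1 w.2.1 w.2.2.1 w.2.2.2) S := by
    have c1 : ContinuousOn (fun w : 𝔼 × 𝔼 × ℝ × ℝ => u w.1 w.2.2.1) S :=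
      huc.comp (f := fun w : 𝔼 × 𝔼 × ℝ × ℝ => (w.1, w.2.2.1))
        (by fun_prop) fun w hw => ⟨trivial, hw.2.2.1.1⟩
    have c2 : ContinuousOn (fun w : 𝔼 × 𝔼 × ℝ × ℝ => v w.2.1 w.2.2.2) S :=
      hvc.comp (f := fun w : 𝔼 × 𝔼 × ℝ × ℝ => (w.2.1, w.2.2.2))
        (by fun_prop) fun w hw => ⟨trivial, hw.2.2.2.1⟩
    have c3 : Continuous fun w : 𝔼 × 𝔼 × ℝ × ℝ => smoothNorm w.1 :=
      contDiff_smoothNorm.continuous.comp continuous_fst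
    exact ((((c1.sub c2).sub (by fun_prop)).sub (by fun_prop)).sub
      (continuous_const.mul c3).continuousOn).sub (by fun_prop)
  have hmem₀ := hSmem x₀ x₀ t₀ t₀ ht₀ ht₀ hpos
  obtain ⟨⟨x, y, t, s⟩, hw, hmax⟩ := hSc.exists_isMaxOn ⟨_, hmem₀⟩ hcont
  refine ⟨x, y, t, s, hw.2.2.1.1, hw.2.2.2.1, fun x' y' t' s' ht' hs' => ?_⟩
  by_cases hp : 0 < doubled u v A γ ρ x' y' t' s'
  · exact hmax (hSmem x' y' t' s' ht' hs' hp)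
  · have := hmax hmem₀
    have h0 : doubled u v A γ ρ x₀ x₀ t₀ t₀ ≤ doubled u v A γ ρ x y t s := this
    linarith

/-- The viscosity inequalities at a maximum point of the doubled function, subtracted. -/
theorem doubled_inequality {h W : 𝔼 → ℝ} {u v : 𝔼 → ℝ → ℝ} {A γ ρ : ℝ}
    (husub : IsViscositySubsolution (fun p x => h p - W x) u)
    (hvsup : IsViscositySupersolution (fun p x => h p - W x) v) {x y : 𝔼} {t s : ℝ}
    (ht0 : 0 < t) (hs0 : 0 < s)
    (hmax : ∀ x' y' t' s', 0 ≤ t' → 0 ≤ s' →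
      doubled u v A γ ρ x' y' t' s' ≤ doubled u v A γ ρ x y t s) :
    ρ * (1 + 2 * t) + h ((2 * A) • (x - y) + γ • (smoothNorm x)⁻¹ • x) - h ((2 * A) • (x - y))
      ≤ W x - W y := by
  have hnhds : ∀ {z : 𝔼} {r : ℝ}, 0 < r → ∀ᶠ w : 𝔼 × ℝ in 𝓝 (z, r), 0 ≤ w.2 := fun {z r} hr =>
    (continuous_snd.tendsto (z, r)).eventually (eventually_ge_nhds hr)
  have hderiv : ∀ B b r : ℝ, HasDerivAt (fun s : ℝ => B * (s - b) ^ 2) (2 * B * (r - b)) r := by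
    intro B b r
    have := (((hasDerivAt_id r).sub_const b).pow 2).const_mul B
    refine this.congr_deriv ?_
    simp
    ring
  have hderiv2 : HasDerivAt (fun s : ℝ => ρ * (s + s ^ 2)) (ρ * (1 + 2 * t)) t := by
    have := ((hasDerivAt_id t).add ((hasDerivAt_id t).pow 2)).const_mul ρ
    refine this.congr_deriv ?_
    simp
  have hsub := sub_testFun_le (A := A) (a := y) (γ := γ) (ξ := 0)
    (g := fun r => A * (r - s) ^ 2 + ρ * (r + r ^ 2)) husub (by fun_prop) ht0 (x := x) (by
      filter_upwards [hnhds ht0] with w hw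
      have := hmax w.1 y w.2 s hw hs0.le
      simp only [doubled] at this
      simp only [testFun, inner_zero_left]
      linarith)
  have hsup := le_super_testFun (A := -A) (a := x) (γ := 0) (ξ := 0)
    (g := fun r => -A * (r - t) ^ 2) hvsup (by fun_prop) hs0 (x := y) (by
      filter_upwards [hnhds hs0] with w hw
      have := hmax x w.1 t w.2 ht0.le hw
      simp only [doubled] at this
      simp only [testFun, inner_zero_left]
      rw [norm_sub_rev w.1 x, norm_sub_rev y x]
      linarith)
  rw [((hderiv A s t).fun_add hderiv2).deriv] at hsub
  rw [(hderiv (-A) t s).deriv] at hsup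
  simp only [zero_smul, add_zero] at hsub hsup
  have hp : (2 * -A) • (y - x) = (2 * A) • (x - y) := by
    rw [← neg_sub x y, smul_neg, mul_neg, neg_smul, neg_neg]
  rw [hp] at hsup
  linarith

/-- Comparison principle for `u_t + h(Du) = W(x)`, between a subsolution and a supersolution of which
one is Lipschitz in space. This Lipschitz bound confines the doubled gradients to a
compact set, so that continuity of `h` suffices. -/
theorem comparison {h W : 𝔼 → ℝ} (hh : Continuous h) {L : ℝ} (hL : 0 ≤ L)
    (hW : ∀ x y, |W x - W y| ≤ L * ‖x - y‖) {u v : 𝔼 → ℝ → ℝ} {ξ : 𝔼} {C K : ℝ}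
    (hC : 0 ≤ C) (hK : 0 ≤ K)
    (huc : ContinuousOn (fun z : 𝔼 × ℝ => u z.1 z.2) (Set.univ ×ˢ Set.Ici 0))
    (hvc : ContinuousOn (fun z : 𝔼 × ℝ => v z.1 z.2) (Set.univ ×ˢ Set.Ici 0))
    (hu : ∀ x t, 0 ≤ t → u x t ≤ inner ℝ ξ x + C * t)
    (hv : ∀ x t, 0 ≤ t → inner ℝ ξ x - C * t ≤ v x t)
    (husub : IsViscositySubsolution (fun p x => h p - W x) u)
    (hvsup : IsViscositySupersolution (fun p x => h p - W x) v)
    (hLip : (∀ x y t, 0 ≤ t → u x t - u y t ≤ K * ‖x - y‖) ∨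
      (∀ x y t, 0 ≤ t → v x t - v y t ≤ K * ‖x - y‖))
    (x₀ : 𝔼) {t₀ : ℝ} (ht₀ : 0 ≤ t₀) : u x₀ t₀ ≤ v x₀ t₀ := by
  by_contra! hlt
  obtain ⟨θ, hθ⟩ : ∃ θ, θ = u x₀ t₀ - v x₀ t₀ := ⟨_, rfl⟩
  have hθ0 : 0 < θ := by linarith
  obtain ⟨ρ, hρ0, hρ⟩ : ∃ ρ, 0 < ρ ∧ ρ * (t₀ + t₀ ^ 2) ≤ θ / 4 := by
    refine ⟨θ / (4 * (1 + (t₀ + t₀ ^ 2))), by positivity, ?_⟩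
    rw [div_mul_eq_mul_div, div_le_iff₀ (by positivity)]
    nlinarith
  obtain ⟨R, hR⟩ : ∃ R, R = 2 * (K + 1) := ⟨_, rfl⟩
  have hR0 : 0 < R := by rw [hR]; positivity
  obtain ⟨γ₀, hγ₀, hmod⟩ : ∃ γ₀ > 0, ∀ p p' : 𝔼, ‖p‖ ≤ R → ‖p' - p‖ ≤ γ₀ → |h p' - h p| < ρ / 2 := by
    have huc := (isCompact_closedBall (0 : 𝔼) (R + 1)).uniformContinuousOn_of_continuous
      hh.continuousOn
    obtain ⟨δ, hδ, H⟩ := Metric.uniformContinuousOn_iff.1 huc (ρ / 2) (by positivity)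
    refine ⟨min 1 (δ / 2), by positivity, fun p p' hp hpp => ?_⟩
    have h1 : ‖p' - p‖ ≤ 1 := hpp.trans (min_le_left _ _)
    have h2 : ‖p' - p‖ ≤ δ / 2 := hpp.trans (min_le_right _ _)
    have h3 : ‖p'‖ ≤ ‖p‖ + ‖p' - p‖ := by simpa using norm_add_le p (p' - p)
    have := H p' (by rw [mem_closedBall_zero_iff]; linarith) p
      (by rw [mem_closedBall_zero_iff]; linarith) (by rw [dist_eq_norm]; linarith)
    rwa [Real.dist_eq] at this
  obtain ⟨γ, hγ0, hγ1, hγγ, hγ⟩ : ∃ γ, 0 < γ ∧ γ ≤ 1 ∧ γ ≤ γ₀ ∧ γ * smoothNorm x₀ ≤ θ / 4 := by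
    have hj := smoothNorm_pos x₀
    refine ⟨min (min 1 γ₀) (θ / 4 / smoothNorm x₀), by positivity,
      (min_le_left _ _).trans (min_le_left _ _), (min_le_left _ _).trans (min_le_right _ _), ?_⟩
    rw [← le_div_iff₀ hj]
    exact min_le_right _ _
  obtain ⟨α, hα0, hα1, hα2⟩ : ∃ α, 0 < α ∧ α * (R * ‖ξ‖ + C ^ 2) < θ / 4 ∧ α * (L * R) < ρ / 2 := by
    have key : ∀ {B r : ℝ}, 0 ≤ B → 0 < r → r / (B + 1) * B < r := by
      intro B r hB hr
      rw [div_mul_eq_mul_div, div_lt_iff₀ (by positivity)]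
      nlinarith
    have hB1 : 0 ≤ R * ‖ξ‖ + C ^ 2 := by positivity
    have hB2 : 0 ≤ L * R := by positivity
    refine ⟨min (θ / 4 / (R * ‖ξ‖ + C ^ 2 + 1)) (ρ / 2 / (L * R + 1)), by positivity, ?_, ?_⟩
    · exact (mul_le_mul_of_nonneg_right (min_le_left _ _) hB1).trans_lt (key hB1 (by positivity))
    · exact (mul_le_mul_of_nonneg_right (min_le_right _ _) hB2).trans_lt (key hB2 (by positivity))
  obtain ⟨A, hA⟩ : ∃ A, A = 1 / (2 * α) := ⟨_, rfl⟩
  have hA0 : 0 < A := by rw [hA]; positivity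
  have hAα : 2 * A * α = 1 := by rw [hA]; field_simp
  have hΦ0 : θ / 2 ≤ doubled u v A γ ρ x₀ x₀ t₀ t₀ := by
    simp only [doubled, sub_self, norm_zero]
    nlinarith
  obtain ⟨x, y, t, s, ht, hs, hmax⟩ := exists_max_doubled hA0 hγ0 hρ0 hC huc hvc hu hv ht₀
    (by linarith : 0 < doubled u v A γ ρ x₀ x₀ t₀ t₀)
  have hΦ : θ / 2 ≤ doubled u v A γ ρ x y t s := hΦ0.trans (hmax _ _ _ _ ht₀ ht₀)
  have hD0 := norm_nonneg (x - y)
  -- the Lipschitz bound controls the distance of the two space points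
  have hAD : A * ‖x - y‖ ^ 2 ≤ (K + 1) * ‖x - y‖ := by
    rcases hLip with hl | hl
    · have h1 := hmax y y t s ht hs
      simp only [doubled, sub_self, norm_zero] at h1
      have h2 := hl x y t ht
      have h3 := smoothNorm_le_add y x
      rw [norm_sub_rev] at h3
      nlinarith
    · have h1 := hmax x x t s ht hs
      simp only [doubled, sub_self, norm_zero] at h1
      have h2 := hl x y s hs
      nlinarith
  have hD : 2 * A * ‖x - y‖ ≤ R := by
    rcases hD0.eq_or_lt with h0 | h0
    · rw [← h0]; linarith
    · have : A * ‖x - y‖ ≤ K + 1 := le_of_mul_le_mul_right (by linarith) h0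
      linarith
  have hDα : ‖x - y‖ ≤ α * R := by
    have : α * (2 * A * ‖x - y‖) ≤ α * R := mul_le_mul_of_nonneg_left hD hα0.le
    calc ‖x - y‖ = 2 * A * α * ‖x - y‖ := by rw [hAα, one_mul]
      _ = α * (2 * A * ‖x - y‖) := by ring
      _ ≤ _ := this
  have hΦle : doubled u v A γ ρ x y t s ≤ ‖ξ‖ * ‖x - y‖ + C * (t + s) - A * (t - s) ^ 2 := by
    have h1 := hu x t ht
    have h2 := hv y s hs
    have h3 : inner ℝ ξ x - inner ℝ ξ y ≤ ‖ξ‖ * ‖x - y‖ := by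
      rw [← inner_sub_right]; exact real_inner_le_norm _ _
    have h4 : 0 ≤ A * ‖x - y‖ ^ 2 := by positivity
    have h5 : 0 ≤ γ * smoothNorm x := by have := smoothNorm_pos x; positivity
    have h6 : 0 ≤ ρ * (t + t ^ 2) := by positivity
    rw [doubled]
    linarith
  have hquad : ∀ r : ℝ, C * r - A * r ^ 2 ≤ α * C ^ 2 := by
    intro r
    have h1 : α * (C * r - A * r ^ 2) ≤ α * (α * C ^ 2) := by
      have : α * (C * r - A * r ^ 2) = α * C * r - r ^ 2 / 2 := by
        linear_combination (-r ^ 2 / 2) * hAα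
      rw [this]
      nlinarith [sq_nonneg (α * C - r), sq_nonneg (α * C)]
    exact le_of_mul_le_mul_left h1 hα0
  have hξD : ‖ξ‖ * ‖x - y‖ ≤ α * (R * ‖ξ‖) := by
    have := mul_le_mul_of_nonneg_left hDα (norm_nonneg ξ)
    linarith
  have ht0 : 0 < t := by
    rcases ht.eq_or_lt with h0 | h0
    · subst h0
      have := hquad s
      linarith
    · exact h0
  have hs0 : 0 < s := by
    rcases hs.eq_or_lt with h0 | h0
    · subst h0
      have := hquad t
      linarith
    · exact h0
  have hineq := doubled_inequality husub hvsup ht0 hs0 hmax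
  have h1 := hmod ((2 * A) • (x - y)) ((2 * A) • (x - y) + γ • (smoothNorm x)⁻¹ • x)
    (by rw [norm_smul, Real.norm_of_nonneg (by positivity)]; exact hD) (by
      rw [add_sub_cancel_left, norm_smul, Real.norm_of_nonneg hγ0.le]
      refine le_trans ?_ hγγ
      exact mul_le_of_le_one_right hγ0.le (norm_inv_smul_smoothNorm_le x))
  have h2 := (abs_lt.1 h1).1
  have h3 := (abs_le.1 (hW x y)).2
  have h4 : L * ‖x - y‖ ≤ α * (L * R) := by
    have := mul_le_mul_of_nonneg_left hDα hL
    linarith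
  have h5 : 0 ≤ ρ * t := by positivity
  linarith

/-! ### Stability of subsolutions -/

/-- If `φ` touches from above a function which itself lies above an affine function and coincides
with it at the contact point, then `φ` has the derivatives of the affine function there. -/
theorem eq_affine_of_isLocalMax {u : 𝔼 → ℝ → ℝ} {φ : 𝔼 × ℝ → ℝ} (hφ : ContDiff ℝ 1 φ)
    {ξ x : 𝔼} {c t : ℝ} (hmax : IsLocalMax (fun z : 𝔼 × ℝ => u z.1 z.2 - φ z) (x, t))
    (heq : u x t = inner ℝ ξ x + c * t)
    (hge : ∀ᶠ z : 𝔼 × ℝ in 𝓝 (x, t), inner ℝ ξ z.1 + c * z.2 ≤ u z.1 z.2) :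
    spaceGrad φ (x, t) = ξ ∧ timeDeriv φ (x, t) = c := by
  have hg : ContDiff ℝ 1 fun s : ℝ => c * s := by fun_prop
  have h1 := eq_of_isLocalMin hφ (contDiff_testFun 0 0 0 ξ hg) (z := (x, t)) (by
    filter_upwards [hmax, hge] with z h1 h2
    simp only [testFun, zero_mul, zero_add]
    linarith)
  rw [spaceGrad_testFun, timeDeriv_testFun] at h1
  have h2 : deriv (fun s : ℝ => c * s) t = c := by
    simp
  rw [h2] at h1
  simpa using h1

/-- The counterpart of `eq_affine_of_isLocalMax` for contact from below. -/
theorem eq_affine_of_isLocalMin {u : 𝔼 → ℝ → ℝ} {φ : 𝔼 × ℝ → ℝ} (hφ : ContDiff ℝ 1 φ)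
    {ξ x : 𝔼} {c t : ℝ} (hmin : IsLocalMin (fun z : 𝔼 × ℝ => u z.1 z.2 - φ z) (x, t))
    (heq : u x t = inner ℝ ξ x + c * t)
    (hle : ∀ᶠ z : 𝔼 × ℝ in 𝓝 (x, t), u z.1 z.2 ≤ inner ℝ ξ z.1 + c * z.2) :
    spaceGrad φ (x, t) = ξ ∧ timeDeriv φ (x, t) = c := by
  have h1 := eq_affine_of_isLocalMax (u := fun x t => -u x t) (φ := fun z => -φ z) (ξ := -ξ)
    (c := -c) (x := x) (t := t) hφ.neg
    (by filter_upwards [hmin] with z hz; linarith)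
    (by rw [heq, inner_neg_left]; ring)
    (by filter_upwards [hle] with z hz; rw [inner_neg_left]; linarith)
  rw [spaceGrad_neg, timeDeriv_neg] at h1
  exact ⟨neg_injective h1.1, neg_injective h1.2⟩

/-- If `φ` touches `u` from below, then the derivative of `φ` in a direction is at most
any upper bound for the slope of `u` in this direction. -/
theorem deriv_le_of_isLocalMin {u : 𝔼 → ℝ → ℝ} {φ : 𝔼 × ℝ → ℝ} (hφ : ContDiff ℝ 1 φ)
    {x v : 𝔼} {t s c : ℝ} (hmin : IsLocalMin (fun z : 𝔼 × ℝ => u z.1 z.2 - φ z) (x, t))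
    (hc : ∀ᶠ r in 𝓝[>] (0 : ℝ), u (x + r • v) (t + r * s) ≤ u x t + r * c) :
    inner ℝ (spaceGrad φ (x, t)) v + timeDeriv φ (x, t) * s ≤ c := by
  have h1 := le_deriv_of_isLocalMax (u := fun x t => -u x t) (φ := fun z => -φ z) (c := -c)
    (x := x) (t := t) (v := v) (s := s) hφ.neg
    (by filter_upwards [hmin] with z hz; linarith)
    (by filter_upwards [hc] with r hr; linarith)
  rw [spaceGrad_neg, timeDeriv_neg, inner_neg_left] at h1
  linarith

theorem IsViscositySubsolution.max {H : 𝔼 → 𝔼 → ℝ} {u v : 𝔼 → ℝ → ℝ}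
    (hu : IsViscositySubsolution H u) (hv : IsViscositySubsolution H v) :
    IsViscositySubsolution H fun x t => max (u x t) (v x t) := by
  intro φ hφ x t ht hmax
  rcases le_total (u x t) (v x t) with h | h
  · refine hv φ hφ x t ht ?_
    filter_upwards [hmax] with z hz
    rw [max_eq_right h] at hz
    linarith [le_max_right (u z.1 z.2) (v z.1 z.2)]
  · refine hu φ hφ x t ht ?_
    filter_upwards [hmax] with z hz
    rw [max_eq_left h] at hz
    linarith [le_max_left (u z.1 z.2) (v z.1 z.2)]

/-- The equation is autonomous: the subsolution inequality is invariant under translations in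
time. -/
theorem sub_timeShift {H : 𝔼 → 𝔼 → ℝ} {v : 𝔼 → ℝ → ℝ} (hv : IsViscositySubsolution H v)
    {φ : 𝔼 × ℝ → ℝ} (hφ : ContDiff ℝ 1 φ) {x : 𝔼} {t s : ℝ} (hts : 0 < t + s)
    (hmax : IsLocalMax (fun z : 𝔼 × ℝ => v z.1 (z.2 + s) - φ z) (x, t)) :
    timeDeriv φ (x, t) + H (spaceGrad φ (x, t)) x ≤ 0 := by
  have hφ' : ContDiff ℝ 1 fun z : 𝔼 × ℝ => φ (z.1, z.2 - s) := by fun_prop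
  have h1 := hv _ hφ' x (t + s) hts (by
    have hc : Tendsto (fun z : 𝔼 × ℝ => (z.1, z.2 - s)) (𝓝 (x, t + s)) (𝓝 (x, t)) := by
      have : Continuous fun z : 𝔼 × ℝ => (z.1, z.2 - s) := by fun_prop
      simpa using this.tendsto (x, t + s)
    filter_upwards [hc.eventually hmax] with z hz
    simpa using hz)
  have h2 : deriv (fun r => φ (x, r - s)) (t + s) = timeDeriv φ (x, t) := by
    rw [deriv_comp_sub_const (f := fun r => φ (x, r)), add_sub_cancel_right]
    rfl
  simp only [add_sub_cancel_right] at h1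
  rw [h2] at h1
  exact h1

/-- The residual of `φ` in the equation `u_t + h(Du) = W(x)`. -/
noncomputable def residual (h W : 𝔼 → ℝ) (φ : 𝔼 × ℝ → ℝ) (z : 𝔼 × ℝ) : ℝ :=
  timeDeriv φ z + (h (spaceGrad φ z) - W z.1)

theorem continuous_residual {h W : 𝔼 → ℝ} (hh : Continuous h) (hW : Continuous W)
    {φ : 𝔼 × ℝ → ℝ} (hφ : ContDiff ℝ 1 φ) : Continuous (residual h W φ) :=
  (continuous_timeDeriv hφ).add
    ((hh.comp (continuous_spaceGrad hφ)).sub (hW.comp continuous_fst))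

/-- The squared distance to a point of space-time. -/
noncomputable def sqDist (x : 𝔼) (t : ℝ) : 𝔼 × ℝ → ℝ :=
  testFun 1 x 0 0 fun s => (s - t) ^ 2

theorem sqDist_apply (x : 𝔼) (t : ℝ) (z : 𝔼 × ℝ) :
    sqDist x t z = ‖z.1 - x‖ ^ 2 + (z.2 - t) ^ 2 := by
  simp [sqDist, testFun]

theorem contDiff_sqDist (x : 𝔼) (t : ℝ) : ContDiff ℝ 1 (sqDist x t) :=
  contDiff_testFun _ _ _ _ (by fun_prop)

theorem dist_sq_le_sqDist (x : 𝔼) (t : ℝ) (z : 𝔼 × ℝ) : dist z (x, t) ^ 2 ≤ sqDist x t z := by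
  rw [sqDist_apply, Prod.dist_eq, dist_eq_norm, Real.dist_eq]
  rcases max_choice ‖z.1 - x‖ |z.2 - t| with h | h
  · rw [h]; linarith [sq_nonneg (z.2 - t)]
  · rw [h, sq_abs]; linarith [sq_nonneg ‖z.1 - x‖]

theorem spaceGrad_sqDist_self (x : 𝔼) (t : ℝ) : spaceGrad (sqDist x t) (x, t) = 0 := by
  rw [sqDist, spaceGrad_testFun]; simp

theorem timeDeriv_sqDist_self (x : 𝔼) (t : ℝ) : timeDeriv (sqDist x t) (x, t) = 0 := by
  rw [sqDist, timeDeriv_testFun]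
  simp

/-- A supremum of subsolutions is a subsolution. -/
theorem sub_of_sup {h W : 𝔼 → ℝ} (hh : Continuous h) (hW : Continuous W)
    {S : Set (𝔼 → ℝ → ℝ)}
    (hcont : ∀ v ∈ S, ContinuousOn (fun z : 𝔼 × ℝ => v z.1 z.2) (Set.univ ×ˢ Set.Ici 0))
    (hsub : ∀ v ∈ S, IsViscositySubsolution (fun p x => h p - W x) v) {u : 𝔼 → ℝ → ℝ}
    (hle : ∀ v ∈ S, ∀ x t, 0 ≤ t → v x t ≤ u x t)
    (happ : ∀ x t, 0 ≤ t → ∀ ε > 0, ∃ v ∈ S, u x t - ε < v x t) :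
    IsViscositySubsolution (fun p x => h p - W x) u := by
  intro φ hφ x t ht hmax
  by_contra! hpos
  change 0 < residual h W φ (x, t) at hpos
  -- `φ + sqDist` touches `u` strictly
  set ψ : 𝔼 × ℝ → ℝ := fun z => φ z + sqDist x t z with hψ
  have hN := contDiff_sqDist x t
  have hψd : ContDiff ℝ 1 ψ := hφ.add hN
  have hres : residual h W ψ (x, t) = residual h W φ (x, t) := by
    have h1 := hφ.differentiable one_ne_zero (x, t)
    have h2 := hN.differentiable one_ne_zero (x, t)
    rw [residual, residual, timeDeriv_add h1 h2, spaceGrad_add h1 h2, spaceGrad_sqDist_self,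
      timeDeriv_sqDist_self, add_zero, add_zero]
  have hev : ∀ᶠ z in 𝓝 (x, t), 0 < residual h W ψ z ∧ 0 < z.2 ∧
      u z.1 z.2 - φ z ≤ u x t - φ (x, t) := by
    refine (((continuous_residual hh hW hψd).tendsto (x, t)).eventually_const_lt
      (by rwa [hres])).and (((continuous_snd.tendsto (x, t)).eventually_const_lt ht).and hmax)
  obtain ⟨r, hr, hball⟩ := Metric.eventually_nhds_iff_ball.1 hev
  obtain ⟨r', hr'0, hr'⟩ : ∃ r', 0 < r' ∧ r' < r := ⟨r / 2, by positivity, by linarith⟩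
  have hball' : ∀ z ∈ Metric.closedBall (x, t) r', 0 < residual h W ψ z ∧ 0 < z.2 ∧
      u z.1 z.2 - φ z ≤ u x t - φ (x, t) := fun z hz =>
    hball z (lt_of_le_of_lt (Metric.mem_closedBall.1 hz) hr')
  obtain ⟨v, hvS, hv⟩ := happ x t ht.le (r' ^ 2) (by positivity)
  have hcomp : IsCompact (Metric.closedBall ((x, t) : 𝔼 × ℝ) r') := isCompact_closedBall _ _
  have hvc : ContinuousOn (fun z : 𝔼 × ℝ => v z.1 z.2 - ψ z) (Metric.closedBall (x, t) r') :=
    ((hcont v hvS).mono fun z hz => ⟨trivial, (hball' z hz).2.1.le⟩).sub hψd.continuous.continuousOn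
  obtain ⟨z, hz, hzmax⟩ := hcomp.exists_isMaxOn ⟨_, Metric.mem_closedBall_self hr'0.le⟩ hvc
  obtain ⟨h1, h2, h3⟩ := hball' z hz
  have h0 : sqDist x t (x, t) = 0 := by simp [sqDist_apply]
  have hlt : dist z (x, t) < r' := by
    by_contra! hge
    have h4 : v x t - ψ (x, t) ≤ v z.1 z.2 - ψ z :=
      hzmax (Metric.mem_closedBall_self hr'0.le)
    have h5 := hle v hvS z.1 z.2 h2.le
    have h6 : r' ^ 2 ≤ dist z (x, t) ^ 2 := pow_le_pow_left₀ hr'0.le hge 2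
    have h7 := dist_sq_le_sqDist x t z
    simp only [hψ, h0] at h4
    linarith
  have := hsub v hvS ψ hψd z.1 z.2 h2
    (hzmax.isLocalMax (Metric.closedBall_mem_nhds_of_mem hlt))
  change residual h W ψ z ≤ 0 at this
  linarith

/-! ### Existence by Perron's method -/

/-- The class of subsolutions used in Perron's method: they are `K`-Lipschitz in space and lie
between the barriers `⟨ξ, x⟩ ± C t`. -/
structure PerronClass (h W : 𝔼 → ℝ) (ξ : 𝔼) (C K : ℝ) (v : 𝔼 → ℝ → ℝ) : Prop where
  cont : ContinuousOn (fun z : 𝔼 × ℝ => v z.1 z.2) (Set.univ ×ˢ Set.Ici 0)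
  lip : ∀ x y t, 0 ≤ t → v x t - v y t ≤ K * ‖x - y‖
  lower : ∀ x t, 0 ≤ t → inner ℝ ξ x - C * t ≤ v x t
  upper : ∀ x t, 0 ≤ t → v x t ≤ inner ℝ ξ x + C * t
  sub : IsViscositySubsolution (fun p x => h p - W x) v

section Perron

variable {h W : EuclideanSpace ℝ (Fin d) → ℝ} {ξ : EuclideanSpace ℝ (Fin d)} {C K : ℝ}

theorem perronClass_affine (hC0 : 0 ≤ C) (hW : ∀ x, |W x| ≤ 1) (hC : |h ξ| + 1 ≤ C) (hK : ‖ξ‖ ≤ K) :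
    PerronClass h W ξ C K fun x t => inner ℝ ξ x - C * t where
  cont := by fun_prop
  lip x y t _ := by
    have h1 : inner ℝ ξ x - inner ℝ ξ y ≤ ‖ξ‖ * ‖x - y‖ := by
      rw [← inner_sub_right]; exact real_inner_le_norm _ _
    have h2 := mul_le_mul_of_nonneg_right hK (norm_nonneg (x - y))
    linarith
  lower x t _ := le_rfl
  upper x t ht := by nlinarith
  sub φ hφ x t ht hmax := by
    obtain ⟨h1, h2⟩ := eq_affine_of_isLocalMax hφ (u := fun x t => inner ℝ ξ x - C * t)
      (ξ := ξ) (c := -C) hmax (by ring)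
      (Eventually.of_forall fun z => by linarith)
    change timeDeriv φ (x, t) + (h (spaceGrad φ (x, t)) - W x) ≤ 0
    rw [h1, h2]
    linarith [le_abs_self (h ξ), neg_abs_le (W x), hW x]

/-- Shifting a member of the class forward in time and lowering it. -/
theorem PerronClass.shift_forward (hC0 : 0 ≤ C) (hW : ∀ x, |W x| ≤ 1) (hC : |h ξ| + 1 ≤ C)
    (hK : ‖ξ‖ ≤ K) {v : 𝔼 → ℝ → ℝ} (hv : PerronClass h W ξ C K v) {s : ℝ} (hs : 0 ≤ s) :
    PerronClass h W ξ C K fun x t => max (v x (t + s) - C * s) (inner ℝ ξ x - C * t) where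
  cont := by
    have h1 : ContinuousOn (fun z : 𝔼 × ℝ => v z.1 (z.2 + s)) (Set.univ ×ˢ Set.Ici 0) :=
      hv.cont.comp (f := fun z : 𝔼 × ℝ => (z.1, z.2 + s)) (by fun_prop)
        fun z hz => ⟨trivial, add_nonneg hz.2 hs⟩
    exact ContinuousOn.sup (h1.sub continuousOn_const) (by fun_prop)
  lip x y t ht := by
    have h1 := hv.lip x y (t + s) (by positivity)
    have h2 := (perronClass_affine hC0 hW hC hK).lip x y t ht
    have h3 := le_max_left (v y (t + s) - C * s) (inner ℝ ξ y - C * t)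
    have h4 := le_max_right (v y (t + s) - C * s) (inner ℝ ξ y - C * t)
    rw [sub_le_iff_le_add]
    exact max_le (by linarith) (by linarith)
  lower x t _ := le_max_right _ _
  upper x t ht := by
    have h1 := hv.upper x (t + s) (by positivity)
    exact max_le (by linarith) (by nlinarith)
  sub := by
    refine IsViscositySubsolution.max ?_ (perronClass_affine hC0 hW hC hK).sub
    intro φ hφ x t ht hmax
    refine sub_timeShift hv.sub hφ (s := s) (by positivity) ?_
    filter_upwards [hmax] with z hz
    linarith

/-- Shifting a member of the class backward in time and lowering it; the lower barrier
fills the initial gap. -/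
theorem PerronClass.shift_backward (hC0 : 0 ≤ C) (hW : ∀ x, |W x| ≤ 1) (hC : |h ξ| + 1 ≤ C)
    {v : 𝔼 → ℝ → ℝ} (hv : PerronClass h W ξ C K v) {s : ℝ} (hs : 0 ≤ s) :
    PerronClass h W ξ C K fun x t => v x (max (t - s) 0) - C * min t s where
  cont := by
    have h1 : ContinuousOn (fun z : 𝔼 × ℝ => v z.1 (max (z.2 - s) 0)) (Set.univ ×ˢ Set.Ici 0) :=
      hv.cont.comp (f := fun z : 𝔼 × ℝ => (z.1, max (z.2 - s) 0)) (by fun_prop)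
        fun z _ => ⟨trivial, le_max_right (z.2 - s) 0⟩
    exact h1.sub (by fun_prop)
  lip x y t _ := by linarith [hv.lip x y (max (t - s) 0) (le_max_right _ _)]
  lower x t ht := by
    have h1 := hv.lower x (max (t - s) 0) (le_max_right _ _)
    rcases le_total t s with h2 | h2
    · rw [max_eq_right (by linarith)] at h1 ⊢
      rw [min_eq_left h2]; linarith
    · rw [max_eq_left (by linarith)] at h1 ⊢
      rw [min_eq_right h2]; linarith
  upper x t ht := by
    have h1 := hv.upper x (max (t - s) 0) (le_max_right _ _)
    rcases le_total t s with h2 | h2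
    · rw [max_eq_right (by linarith)] at h1 ⊢
      rw [min_eq_left h2]; nlinarith
    · rw [max_eq_left (by linarith)] at h1 ⊢
      rw [min_eq_right h2]; nlinarith
  sub φ hφ x t ht hmax := by
    rcases lt_or_ge s t with h1 | h1
    · refine sub_timeShift hv.sub hφ (s := -s) (by linarith) ?_
      have hev : ∀ᶠ z : 𝔼 × ℝ in 𝓝 (x, t), s < z.2 :=
        (continuous_snd.tendsto (x, t)).eventually_const_lt h1
      filter_upwards [hmax, hev] with z hz hzs
      rw [max_eq_left (by linarith), max_eq_left (by linarith), min_eq_right h1.le,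
        min_eq_right hzs.le] at hz
      simp only [← sub_eq_add_neg]
      linarith
    · have hev : ∀ᶠ z : 𝔼 × ℝ in 𝓝 (x, t), 0 < z.2 :=
        (continuous_snd.tendsto (x, t)).eventually_const_lt ht
      obtain ⟨h2, h3⟩ := eq_affine_of_isLocalMax hφ
        (u := fun x t => v x (max (t - s) 0) - C * min t s) (ξ := ξ) (c := -C) hmax
        (by
          have h4 := hv.lower x 0 le_rfl
          have h5 := hv.upper x 0 le_rfl
          rw [max_eq_right (by linarith), min_eq_left h1]
          linarith)
        (by
          filter_upwards [hev] with z hz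
          have h4 := hv.lower z.1 (max (z.2 - s) 0) (le_max_right _ _)
          rcases le_total z.2 s with h5 | h5
          · rw [max_eq_right (by linarith)] at h4 ⊢
            rw [min_eq_left h5]; linarith
          · rw [max_eq_left (by linarith)] at h4 ⊢
            rw [min_eq_right h5]; linarith)
      change timeDeriv φ (x, t) + (h (spaceGrad φ (x, t)) - W x) ≤ 0
      rw [h2, h3]
      linarith [le_abs_self (h ξ), neg_abs_le (W x), hW x]

/-- The supremum of the Perron class. -/
noncomputable def perronSup (h W : 𝔼 → ℝ) (ξ : 𝔼) (C K : ℝ) (x : 𝔼) (t : ℝ) : ℝ :=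
  ⨆ v : {v // PerronClass h W ξ C K v}, v.1 x t

theorem PerronClass.le_perronSup {v : 𝔼 → ℝ → ℝ} (hv : PerronClass h W ξ C K v) (x : 𝔼) {t : ℝ}
    (ht : 0 ≤ t) : v x t ≤ perronSup h W ξ C K x t :=
  le_ciSup (f := fun v : {v // PerronClass h W ξ C K v} => v.1 x t)
    ⟨inner ℝ ξ x + C * t, by rintro _ ⟨w, rfl⟩; exact w.2.upper x t ht⟩ ⟨v, hv⟩

theorem perronSup_le (hne : ∃ v, PerronClass h W ξ C K v) {x : 𝔼} {t b : ℝ}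
    (hb : ∀ v, PerronClass h W ξ C K v → v x t ≤ b) : perronSup h W ξ C K x t ≤ b :=
  have : Nonempty {v // PerronClass h W ξ C K v} := hne.elim fun v hv => ⟨⟨v, hv⟩⟩
  ciSup_le fun v => hb v.1 v.2

theorem perronSup_lip (hne : ∃ v, PerronClass h W ξ C K v) (x y : 𝔼) {t : ℝ} (ht : 0 ≤ t) :
    perronSup h W ξ C K x t - perronSup h W ξ C K y t ≤ K * ‖x - y‖ := by
  rw [sub_le_iff_le_add]
  refine perronSup_le hne fun v hv => ?_
  linarith [hv.lip x y t ht, hv.le_perronSup y ht]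

/-- The supremum of the Perron class is `C`-Lipschitz in time, since the class is invariant under
translations in time. -/
theorem perronSup_time (hC0 : 0 ≤ C) (hW : ∀ x, |W x| ≤ 1) (hC : |h ξ| + 1 ≤ C)
    (hK : ‖ξ‖ ≤ K) (x : 𝔼) {t s : ℝ} (ht : 0 ≤ t) (hs : 0 ≤ s) :
    |perronSup h W ξ C K x t - perronSup h W ξ C K x s| ≤ C * |t - s| := by
  have hne : ∃ v, PerronClass h W ξ C K v := ⟨_, perronClass_affine hC0 hW hC hK⟩
  have key : ∀ {t s : ℝ}, 0 ≤ t → t ≤ s →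
      |perronSup h W ξ C K x t - perronSup h W ξ C K x s| ≤ C * (s - t) := by
    intro t s ht hts
    have hr : 0 ≤ s - t := by linarith
    rw [abs_sub_le_iff]
    constructor
    · rw [sub_le_iff_le_add]
      refine perronSup_le hne fun v hv => ?_
      have h1 := (hv.shift_backward hC0 hW hC hr).le_perronSup x (ht.trans hts)
      rw [max_eq_left (by linarith), sub_sub_cancel] at h1
      have h2 : C * min s (s - t) ≤ C * (s - t) := mul_le_mul_of_nonneg_left (min_le_right _ _) hC0
      linarith
    · rw [sub_le_iff_le_add]
      refine perronSup_le hne fun v hv => ?_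
      have h1 := (hv.shift_forward hC0 hW hC hK hr).le_perronSup x ht
      have h2 := (le_max_left _ _).trans h1
      rw [add_sub_cancel] at h2
      linarith
  rcases le_total t s with h1 | h1
  · rw [abs_of_nonpos (by linarith : t - s ≤ 0), neg_sub]
    exact key ht h1
  · rw [abs_of_nonneg (by linarith : 0 ≤ t - s), abs_sub_comm]
    exact key hs h1

theorem continuousOn_perronSup (hC0 : 0 ≤ C) (hW : ∀ x, |W x| ≤ 1) (hC : |h ξ| + 1 ≤ C)
    (hK : ‖ξ‖ ≤ K) :
    ContinuousOn (fun z : 𝔼 × ℝ => perronSup h W ξ C K z.1 z.2) (Set.univ ×ˢ Set.Ici 0) := by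
  have hne : ∃ v, PerronClass h W ξ C K v := ⟨_, perronClass_affine hC0 hW hC hK⟩
  have hK0 : 0 ≤ K := (norm_nonneg _).trans hK
  have : LipschitzOnWith (Real.toNNReal (K + C))
      (fun z : 𝔼 × ℝ => perronSup h W ξ C K z.1 z.2) (Set.univ ×ˢ Set.Ici 0) := by
    refine LipschitzOnWith.of_le_add_mul _ fun z hz w hw => ?_
    rw [Real.coe_toNNReal _ (by positivity)]
    have h1 := perronSup_lip hne z.1 w.1 (hz.2 : 0 ≤ z.2)
    have h2 := (abs_le.1 (perronSup_time hC0 hW hC hK w.1 (hz.2 : 0 ≤ z.2) (hw.2 : 0 ≤ w.2))).2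
    have h3 : ‖z.1 - w.1‖ ≤ dist z w := by
      rw [← dist_eq_norm]; exact le_max_left _ _
    have h4 : |z.2 - w.2| ≤ dist z w := by
      rw [← Real.dist_eq]; exact le_max_right _ _
    have h5 := mul_le_mul_of_nonneg_left h3 hK0
    have h6 := mul_le_mul_of_nonneg_left h4 hC0
    linarith
  exact this.continuousOn

theorem perronSup_sub (hh : Continuous h) (hWc : Continuous W) (hne : ∃ v, PerronClass h W ξ C K v) :
    IsViscositySubsolution (fun p x => h p - W x) (perronSup h W ξ C K) := by
  refine sub_of_sup hh hWc (S := {v | PerronClass h W ξ C K v}) (fun v hv => hv.cont)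
    (fun v hv => hv.sub) (fun v hv x t ht => hv.le_perronSup x ht) fun x t ht ε hε => ?_
  have : Nonempty {v // PerronClass h W ξ C K v} := hne.elim fun v hv => ⟨⟨v, hv⟩⟩
  obtain ⟨v, hv⟩ := exists_lt_of_lt_ciSup
    (show perronSup h W ξ C K x t - ε < ⨆ v : {v // PerronClass h W ξ C K v}, v.1 x t by
      change perronSup h W ξ C K x t - ε < perronSup h W ξ C K x t
      linarith)
  exact ⟨v.1, v.2, hv⟩

/-- The bump of Perron's method: raise `u` to `φ` in a ball. -/
noncomputable def bump (u : 𝔼 → ℝ → ℝ) (φ : 𝔼 × ℝ → ℝ) (x : 𝔼) (t r : ℝ) (y : 𝔼) (s : ℝ) : ℝ :=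
  open Classical in if dist (y, s) (x, t) < r then max (u y s) (φ (y, s)) else u y s

/-- A member of the Perron class may be raised to a strict subsolution in a small ball,
provided that the latter lies below it near the boundary of the ball. -/
theorem PerronClass.bump {u : 𝔼 → ℝ → ℝ} (hu : PerronClass h W ξ C K u)
    {φ : 𝔼 × ℝ → ℝ} (hφ : ContDiff ℝ 1 φ) {x : 𝔼} {t r : ℝ} (hr : 0 < r)
    (hball : ∀ z, dist z (x, t) < r → residual h W φ z ≤ 0 ∧ ‖spaceGrad φ z‖ ≤ K ∧ 0 < z.2 ∧
      φ z ≤ inner ℝ ξ z.1 + C * z.2)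
    (hbdry : ∀ z, dist z (x, t) < r → r / 2 ≤ dist z (x, t) → φ z ≤ u z.1 z.2) :
    PerronClass h W ξ C K (Viscosity.bump u φ x t r) := by
  classical
  have hge : ∀ y s, u y s ≤ Viscosity.bump u φ x t r y s := by
    intro y s
    unfold Viscosity.bump
    split_ifs
    · exact le_max_left _ _
    · exact le_rfl
  have hgeφ : ∀ z : 𝔼 × ℝ, dist z (x, t) < r → φ z ≤ Viscosity.bump u φ x t r z.1 z.2 := by
    intro z hz
    unfold Viscosity.bump
    rw [if_pos hz]
    exact le_max_right _ _
  have hcases : ∀ y s, Viscosity.bump u φ x t r y s = u y s ∨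
      (dist (y, s) (x, t) < r ∧ u y s < φ (y, s) ∧ Viscosity.bump u φ x t r y s = φ (y, s)) := by
    intro y s
    unfold Viscosity.bump
    split_ifs with hd
    · rcases le_or_gt (φ (y, s)) (u y s) with h1 | h1
      · exact Or.inl (max_eq_left h1)
      · exact Or.inr ⟨hd, h1, max_eq_right h1.le⟩
    · exact Or.inl rfl
  -- the gradient bound in the ball
  have hLipφ : ∀ y z s, dist (y, s) (x, t) < r → dist (z, s) (x, t) < r →
      φ (y, s) - φ (z, s) ≤ K * ‖y - z‖ := by
    intro y z s hy hz
    have hst : |s - t| < r := by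
      rw [← Real.dist_eq]; exact (le_max_right _ _).trans_lt hy
    have hconv : Convex ℝ (Metric.ball x r) := convex_ball x r
    have hin : ∀ w ∈ Metric.ball x r, dist (w, s) (x, t) < r := fun w hw =>
      max_lt hw (by rwa [← Real.dist_eq] at hst)
    have := hconv.norm_image_sub_le_of_norm_hasFDerivWithin_le (𝕜 := ℝ) (f := fun w => φ (w, s))
      (f' := fun w => InnerProductSpace.toDual ℝ 𝔼 (spaceGrad φ (w, s))) (C := K)
      (fun w _ => by
        have h1 := hasFDerivAt_slice_space (hφ.differentiable one_ne_zero (w, s))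
        have h2 := h1.differentiableAt.hasGradientAt
        exact h2.hasFDerivAt.hasFDerivWithinAt)
      (fun w hw => by
        rw [LinearIsometryEquiv.norm_map]
        exact (hball (w, s) (hin w hw)).2.1)
      (show z ∈ Metric.ball x r from (le_max_left _ _).trans_lt hz)
      (show y ∈ Metric.ball x r from (le_max_left _ _).trans_lt hy)
    exact (le_abs_self _).trans this
  refine ⟨?_, ?_, ?_, ?_, ?_⟩
  · -- continuity
    intro z hz
    rcases lt_or_ge (dist z (x, t)) r with hd | hd
    · have hev : ∀ᶠ w : 𝔼 × ℝ in 𝓝 z, dist w (x, t) < r :=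
        (continuous_id.dist continuous_const).continuousAt.eventually_lt_const hd
      have h1 : ContinuousWithinAt (fun w : 𝔼 × ℝ => max (u w.1 w.2) (φ w))
          (Set.univ ×ˢ Set.Ici 0) z :=
        ContinuousWithinAt.sup (hu.cont z hz) hφ.continuous.continuousWithinAt
      have heq : ∀ w : 𝔼 × ℝ, dist w (x, t) < r →
          Viscosity.bump u φ x t r w.1 w.2 = max (u w.1 w.2) (φ w) := fun w hw => if_pos hw
      exact h1.congr_of_eventuallyEq
        ((hev.filter_mono nhdsWithin_le_nhds).mono heq) (heq z hd)
    · have hev : ∀ᶠ w : 𝔼 × ℝ in 𝓝 z, r / 2 < dist w (x, t) :=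
        (continuous_id.dist continuous_const).continuousAt.eventually_const_lt
          (by linarith : r / 2 < dist z (x, t))
      have heq : ∀ w : 𝔼 × ℝ, r / 2 < dist w (x, t) →
          Viscosity.bump u φ x t r w.1 w.2 = u w.1 w.2 := by
        intro w hw
        rcases hcases w.1 w.2 with h1 | ⟨h1, h2, h3⟩
        · exact h1
        · exact absurd (hbdry w h1 hw.le) (not_le.2 h2)
      exact (hu.cont z hz).congr_of_eventuallyEq
        ((hev.filter_mono nhdsWithin_le_nhds).mono heq) (heq z (by linarith))
  · -- Lipschitz bound
    intro y z s hs
    rcases hcases y s with h1 | ⟨h1, h2, h3⟩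
    · rw [h1]
      linarith [hu.lip y z s hs, hge z s]
    rw [h3]
    by_cases hz : dist (z, s) (x, t) < r
    · linarith [hLipφ y z s h1 hz, hgeφ (z, s) hz]
    have hy : dist (y, s) (x, t) < r / 2 := by
      by_contra! hd
      exact absurd (hbdry (y, s) h1 hd) (not_le.2 h2)
    rw [Prod.dist_eq, max_lt_iff] at hy
    rw [Prod.dist_eq, max_lt_iff, not_and_or, not_lt, not_lt] at hz
    replace hz : r ≤ dist z x := by
      rcases hz with hz | hz
      · exact hz
      · have := hy.2
        dsimp only at hz this
        linarith
    -- a point of the segment at an intermediate distance from the centre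
    obtain ⟨l, hl, hdl⟩ : ∃ l ∈ Set.Icc (0 : ℝ) 1, dist (AffineMap.lineMap y z l) x = 3 * r / 4 := by
      have hc : ContinuousOn (fun l : ℝ => dist (AffineMap.lineMap y z l) x) (Set.Icc 0 1) :=
        (AffineMap.lineMap_continuous.dist continuous_const).continuousOn
      have := intermediate_value_Icc zero_le_one hc
      rw [AffineMap.lineMap_apply_zero, AffineMap.lineMap_apply_one] at this
      obtain ⟨l, hl, he⟩ := this (show 3 * r / 4 ∈ Set.Icc (dist y x) (dist z x) from
        ⟨by have := hy.1; dsimp only at this; linarith, by linarith⟩)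
      exact ⟨l, hl, he⟩
    set w := AffineMap.lineMap y z l with hw
    have hw1 : dist (w, s) (x, t) < r := by
      rw [Prod.dist_eq, max_lt_iff]
      refine ⟨by dsimp only; linarith, ?_⟩
      have := hy.2
      linarith
    have hw2 : r / 2 ≤ dist (w, s) (x, t) := by
      refine le_trans ?_ (le_max_left _ _)
      dsimp only
      linarith
    have hseg : ‖y - w‖ + ‖w - z‖ = ‖y - z‖ := by
      rw [← dist_eq_norm, ← dist_eq_norm, ← dist_eq_norm, hw, dist_left_lineMap, dist_lineMap_right,
        Real.norm_of_nonneg hl.1, Real.norm_of_nonneg (by linarith [hl.2])]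
      ring
    have h4 := hLipφ y w s h1 hw1
    have h5 := hbdry (w, s) hw1 hw2
    have h6 := hu.lip w z s hs
    have h7 := hge z s
    dsimp only at h5
    rw [← hseg]
    linarith
  · intro y s hs
    exact (hu.lower y s hs).trans (hge y s)
  · intro y s hs
    rcases hcases y s with h1 | ⟨h1, -, h3⟩
    · rw [h1]; exact hu.upper y s hs
    · rw [h3]; exact (hball (y, s) h1).2.2.2
  · intro ψ hψ y s hs hmax
    rcases hcases y s with h1 | ⟨h1, -, h3⟩
    · refine hu.sub ψ hψ y s hs ?_
      filter_upwards [hmax] with z hz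
      rw [h1] at hz
      linarith [hge z.1 z.2]
    · have hev : ∀ᶠ w : 𝔼 × ℝ in 𝓝 (y, s), dist w (x, t) < r :=
        (continuous_id.dist continuous_const).continuousAt.eventually_lt_const h1
      obtain ⟨h4, h5⟩ := eq_of_isLocalMin hψ hφ (z := (y, s)) (by
        filter_upwards [hmax, hev] with z hz hzd
        rw [h3] at hz
        have := hgeφ z hzd
        linarith)
      have h6 := (hball (y, s) h1).1
      rw [residual, ← h4, ← h5] at h6
      exact h6

/-- The supremum of the Perron class is a supersolution: otherwise it could be raised
by a bump. -/
theorem perronSup_super (hh : Continuous h) (hWc : Continuous W) (hW : ∀ x, |W x| ≤ 1)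
    (hC0 : 0 ≤ C) (hC : |h ξ| + 1 ≤ C) (hK : ‖ξ‖ ≤ K) (hKh : ∀ p, h p ≤ C + 1 → ‖p‖ < K) :
    IsViscositySupersolution (fun p x => h p - W x) (perronSup h W ξ C K) := by
  have hne : ∃ v, PerronClass h W ξ C K v := ⟨_, perronClass_affine hC0 hW hC hK⟩
  have hup : ∀ x t, 0 ≤ t → perronSup h W ξ C K x t ≤ inner ℝ ξ x + C * t := fun x t ht =>
    perronSup_le hne fun v hv => hv.upper x t ht
  have hu : PerronClass h W ξ C K (perronSup h W ξ C K) :=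
    ⟨continuousOn_perronSup hC0 hW hC hK, fun x y t ht => perronSup_lip hne x y ht,
      fun x t ht => (perronClass_affine hC0 hW hC hK).le_perronSup x ht, hup,
      perronSup_sub hh hWc hne⟩
  have hutime := fun (x : 𝔼) (t s : ℝ) => perronSup_time (t := t) (s := s) hC0 hW hC hK x
  have hmaxl : ∀ v, PerronClass h W ξ C K v → ∀ x t, 0 ≤ t → v x t ≤ perronSup h W ξ C K x t :=
    fun v hv x t ht => hv.le_perronSup x ht
  generalize perronSup h W ξ C K = u at hu hup hutime hmaxl ⊢
  intro φ hφ x t ht hmin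
  by_contra! hneg
  change residual h W φ (x, t) < 0 at hneg
  have htime : -C ≤ timeDeriv φ (x, t) := by
    have := deriv_le_of_isLocalMin hφ (v := 0) (s := -1) (c := C) hmin (by
      have : ∀ᶠ r in 𝓝[>] (0 : ℝ), r < t :=
        (eventually_lt_nhds ht).filter_mono nhdsWithin_le_nhds
      filter_upwards [this, self_mem_nhdsWithin] with r hr (hr0 : 0 < r)
      have h1 := (abs_le.1 (hutime x (t - r) t (by linarith) ht.le)).2
      rw [sub_sub_cancel_left, abs_neg, abs_of_pos hr0] at h1
      rw [smul_zero, add_zero, mul_neg_one, ← sub_eq_add_neg]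
      linarith)
    simp only [inner_zero_right, zero_add] at this
    linarith
  have hgrad : ‖spaceGrad φ (x, t)‖ < K := by
    refine hKh _ ?_
    rw [residual] at hneg
    dsimp only at hneg
    linarith [le_abs_self (W x), hW x]
  have hlt : u x t < inner ℝ ξ x + C * t := by
    refine lt_of_le_of_ne (hup x t ht.le) fun heq => ?_
    have hev : ∀ᶠ z : 𝔼 × ℝ in 𝓝 (x, t), 0 < z.2 :=
      (continuous_snd.tendsto (x, t)).eventually_const_lt ht
    obtain ⟨h1, h2⟩ := eq_affine_of_isLocalMin hφ hmin heq
      (hev.mono fun z hz => hup z.1 z.2 hz.le)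
    rw [residual, h1, h2] at hneg
    dsimp only at hneg
    linarith [neg_abs_le (h ξ), le_abs_self (W x), hW x]
  -- lower `φ` off the contact point
  set ψ : 𝔼 × ℝ → ℝ := fun z => φ z + -sqDist x t z with hψ
  have hN := contDiff_sqDist x t
  have hψd : ContDiff ℝ 1 ψ := hφ.add hN.neg
  have hd1 := hφ.differentiable one_ne_zero (x, t)
  have hd2 := hN.neg.differentiable one_ne_zero (x, t)
  have hgr : spaceGrad ψ (x, t) = spaceGrad φ (x, t) := by
    rw [hψ, spaceGrad_add hd1 hd2, spaceGrad_neg, spaceGrad_sqDist_self, neg_zero, add_zero]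
  have hti : timeDeriv ψ (x, t) = timeDeriv φ (x, t) := by
    rw [hψ, timeDeriv_add hd1 hd2, timeDeriv_neg, timeDeriv_sqDist_self, neg_zero, add_zero]
  have hself : sqDist x t (x, t) = 0 := by simp [sqDist_apply]
  have hψself : ψ (x, t) = φ (x, t) := by simp [hψ, hself]
  obtain ⟨m, hm0, hm⟩ : ∃ m, 0 < m ∧ u x t + m < inner ℝ ξ x + C * t :=
    ⟨(inner ℝ ξ x + C * t - u x t) / 2, by linarith, by linarith⟩
  have hev : ∀ᶠ z in 𝓝 (x, t), residual h W ψ z < 0 ∧ ‖spaceGrad ψ z‖ < K ∧ 0 < z.2 ∧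
      ψ z + (u x t - φ (x, t) + m) - (inner ℝ ξ z.1 + C * z.2) < 0 ∧
      u x t - φ (x, t) ≤ u z.1 z.2 - φ z := by
    refine (((continuous_residual hh hWc hψd).tendsto (x, t)).eventually_lt_const ?_).and
      ((((continuous_spaceGrad hψd).norm.tendsto (x, t)).eventually_lt_const ?_).and
      (((continuous_snd.tendsto (x, t)).eventually_const_lt ht).and
      (Tendsto.eventually_lt_const (v := u x t + m - (inner ℝ ξ x + C * t)) ?_ ?_ |>.and hmin)))
    · rw [residual, hgr, hti]; exact hneg
    · rw [hgr]; exact hgrad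
    · linarith
    · have hc : Continuous fun z : 𝔼 × ℝ =>
          ψ z + (u x t - φ (x, t) + m) - (inner ℝ ξ z.1 + C * z.2) := by
        have := hψd.continuous
        fun_prop
      have := hc.tendsto (x, t)
      rw [hψself] at this
      convert this using 2
      ring
  obtain ⟨r, hr, hball⟩ := Metric.eventually_nhds_iff_ball.1 hev
  obtain ⟨a, ha0, ham, har⟩ : ∃ a, 0 < a ∧ a ≤ m ∧ a ≤ r ^ 2 / 4 :=
    ⟨min m (r ^ 2 / 4), by positivity, min_le_left _ _, min_le_right _ _⟩
  set χ : 𝔼 × ℝ → ℝ := fun z => ψ z + (u x t - φ (x, t) + a) with hχ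
  have hχd : ContDiff ℝ 1 χ := hψd.add contDiff_const
  have hχg : ∀ z, spaceGrad χ z = spaceGrad ψ z := fun z => by
    simp only [spaceGrad, hχ, gradient, fderiv_add_const]
  have hχt : ∀ z, timeDeriv χ z = timeDeriv ψ z := fun z => by
    simp only [timeDeriv, hχ, deriv_add_const]
  have hbump := hu.bump hχd (x := x) (t := t) hr (fun z hz => by
      obtain ⟨h1, h2, h3, h4, -⟩ := hball z hz
      refine ⟨?_, ?_, h3, ?_⟩
      · rw [residual, hχg, hχt]; exact h1.le
      · rw [hχg]; exact h2.le
      · simp only [hχ]; linarith)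
    (fun z hz hz2 => by
      obtain ⟨-, -, -, -, h5⟩ := hball z hz
      have h6 := dist_sq_le_sqDist x t z
      have h7 : (r / 2) ^ 2 ≤ dist z (x, t) ^ 2 := pow_le_pow_left₀ (by positivity) hz2 2
      simp only [hχ, hψ]
      linarith)
  have h1 := hmaxl _ hbump x t ht.le
  have h2 : χ (x, t) ≤ Viscosity.bump u χ x t r x t := by
    rw [Viscosity.bump, if_pos (by simpa using hr)]
    exact le_max_right _ _
  simp only [hχ, hψself] at h2 h1
  linarith

end Perron

theorem exists_bound_near {h : 𝔼 → ℝ} (hh : Continuous h) (ξ : 𝔼) :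
    ∃ C, 0 ≤ C ∧ ∀ p, ‖p - ξ‖ ≤ 1 → |h p| + 1 ≤ C := by
  obtain ⟨B, hB⟩ := (isCompact_closedBall ξ 1).exists_bound_of_continuousOn hh.continuousOn
  have hB0 : 0 ≤ B := (norm_nonneg _).trans (hB ξ (by simp))
  refine ⟨B + 1, by positivity, fun p hp => ?_⟩
  have := hB p (by rwa [mem_closedBall_iff_norm])
  rw [Real.norm_eq_abs] at this
  linarith
theorem _root_.IsViscositySolution.le_bound {h W : 𝔼 → ℝ} {ξ : 𝔼} {v : 𝔼 → ℝ → ℝ}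
    (hv : IsViscositySolution (fun p x => h p - W x) ξ v) {C : ℝ}
    (hC : ∀ p, ‖p - ξ‖ ≤ 1 → |h p| + 1 ≤ C) (hW : ∀ x, W x ∈ Set.Icc (-1 : ℝ) 1) (x : 𝔼) {t : ℝ}
    (ht : 0 ≤ t) : v x t ≤ inner ℝ ξ x + C * t :=
  sub_le_of_bounded hC (fun x => (hW x).2) hv.continuousOn hv.initial
    (fun T => (hv.bounded T).imp fun _ hM x t ht => (abs_le.1 (hM x t ht)).2) hv.sub x ht

theorem _root_.IsViscositySolution.le_of_bound {h W : 𝔼 → ℝ} {ξ : 𝔼} {v : 𝔼 → ℝ → ℝ}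
    (hv : IsViscositySolution (fun p x => h p - W x) ξ v) {C : ℝ}
    (hC : ∀ p, ‖p - ξ‖ ≤ 1 → |h p| + 1 ≤ C) (hW : ∀ x, W x ∈ Set.Icc (-1 : ℝ) 1) (x : 𝔼) {t : ℝ}
    (ht : 0 ≤ t) : inner ℝ ξ x - C * t ≤ v x t :=
  le_super_of_bounded hC (fun x => (hW x).1) hv.continuousOn hv.initial
    (fun T => (hv.bounded T).imp fun M hM x t ht => by
      have := (abs_le.1 (hM x t ht)).1
      linarith) hv.super x ht

/-- Existence and uniqueness for the initial value problem. -/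
theorem exists_isTheViscositySolution {h W : 𝔼 → ℝ} (hh : Continuous h)
    (hcoer : IsCoerciveHamiltonian h) {L : ℝ} (hL : 0 ≤ L)
    (hWL : ∀ x y, |W x - W y| ≤ L * ‖x - y‖) (hW : ∀ x, |W x| ≤ 1) (ξ : 𝔼) :
    ∃ u, IsTheViscositySolution (fun p x => h p - W x) ξ u := by
  have hWc : Continuous W := by
    have : LipschitzWith (Real.toNNReal L) W := by
      refine LipschitzWith.of_dist_le_mul fun x y => ?_
      rw [Real.coe_toNNReal _ hL, Real.dist_eq, dist_eq_norm]
      exact hWL x y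
    exact this.continuous
  -- a common bound for `h` near `ξ` controls all solutions
  obtain ⟨C, hC0, hC⟩ := exists_bound_near hh ξ
  have hCξ := hC ξ (by simp)
  obtain ⟨K, hK0, hK, hKh⟩ : ∃ K, 0 ≤ K ∧ ‖ξ‖ ≤ K ∧ ∀ p, h p ≤ C + 1 → ‖p‖ < K := by
    have h1 : ∀ᶠ p in cocompact 𝔼, C + 1 < h p := hcoer.eventually_gt_atTop (C + 1)
    rw [← Metric.cobounded_eq_cocompact, ← comap_norm_atTop, eventually_comap] at h1
    obtain ⟨B, hB⟩ := eventually_atTop.1 h1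
    refine ⟨max (max B ‖ξ‖) 0, le_max_right _ _, (le_max_right _ _).trans (le_max_left _ _),
      fun p hp => ?_⟩
    by_contra! hge
    have := hB ‖p‖ (((le_max_left _ _).trans (le_max_left _ _)).trans hge) p rfl
    linarith
  have hne : ∃ v, PerronClass h W ξ C K v := ⟨_, perronClass_affine hC0 hW hCξ hK⟩
  have hbelow : ∀ x t, 0 ≤ t → inner ℝ ξ x - C * t ≤ perronSup h W ξ C K x t := fun x t ht =>
    (perronClass_affine hC0 hW hCξ hK).le_perronSup x ht
  have habove : ∀ x t, 0 ≤ t → perronSup h W ξ C K x t ≤ inner ℝ ξ x + C * t := fun x t ht =>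
    perronSup_le hne fun v hv => hv.upper x t ht
  have hcont := continuousOn_perronSup (h := h) (W := W) hC0 hW hCξ hK
  have hsub := perronSup_sub hh hWc hne
  have hsup := perronSup_super hh hWc hW hC0 hCξ hK hKh
  have hlip := fun (x y : 𝔼) (t : ℝ) => perronSup_lip (t := t) hne x y
  refine ⟨perronSup h W ξ C K, ⟨hcont, fun x => ?_, fun T => ⟨C * T, fun x t ht => ?_⟩, hsub, hsup⟩,
    fun v hv x t ht => ?_⟩
  · exact le_antisymm (by simpa using habove x 0 le_rfl) (by simpa using hbelow x 0 le_rfl)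
  · have h1 := hbelow x t ht.1
    have h2 := habove x t ht.1
    have h3 : C * t ≤ C * T := mul_le_mul_of_nonneg_left ht.2 hC0
    rw [abs_le]
    constructor <;> linarith
  · have hW' := fun x => abs_le.1 (hW x)
    have hva := fun (x : 𝔼) (t : ℝ) => hv.le_bound (t := t) hC hW' x
    have hvb := fun (x : 𝔼) (t : ℝ) => hv.le_of_bound (t := t) hC hW' x
    exact le_antisymm
      (comparison hh hL hWL hC0 hK0 hv.continuousOn hcont hva hbelow hv.sub hsup (Or.inr hlip) x ht)
      (comparison hh hL hWL hC0 hK0 hcont hv.continuousOn habove hvb hsub hv.super (Or.inl hlip) x ht)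

/-! ### Growth forced by a hyperplane -/

/-- The component of `x` orthogonal to the unit vector `e`. -/
noncomputable def perp (e x : 𝔼) : 𝔼 := x - (inner ℝ e x : ℝ) • e

theorem perp_add_smul {e : 𝔼} (he : ‖e‖ = 1) (x : 𝔼) (r : ℝ) : perp e (x + r • e) = perp e x := by
  simp only [perp, inner_add_right, inner_smul_right, real_inner_self_eq_norm_sq, he, add_smul]
  simp

theorem inner_perp {e : 𝔼} (he : ‖e‖ = 1) (x : 𝔼) : inner ℝ e (perp e x) = 0 := by
  simp [perp, inner_sub_right, inner_smul_right, he]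

theorem perp_sub (e x y : 𝔼) : perp e (x - y) = perp e x - perp e y := by
  simp only [perp, inner_sub_right, sub_smul]; abel

theorem norm_perp_le {e : 𝔼} (he : ‖e‖ = 1) (x : 𝔼) : ‖perp e x‖ ≤ 2 * ‖x‖ := by
  have h1 : |inner ℝ e x| ≤ ‖x‖ := by simpa [he] using abs_real_inner_le_norm e x
  have h2 := norm_sub_le x ((inner ℝ e x : ℝ) • e)
  rw [norm_smul, he, mul_one, Real.norm_eq_abs] at h2
  rw [perp]; linarith

theorem norm_le_abs_inner_add_norm_perp {e : 𝔼} (he : ‖e‖ = 1) (x : 𝔼) :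
    ‖x‖ ≤ |inner ℝ e x| + ‖perp e x‖ := by
  have := norm_add_le ((inner ℝ e x : ℝ) • e) (perp e x)
  rw [norm_smul, he, mul_one, Real.norm_eq_abs, perp, add_sub_cancel] at this
  exact this

/-- The roof over the hyperplane `⟨e, x⟩ = c`: steep across the hyperplane and gently sloped along
it, rising at rate `δ / 2 - η` until time `T`. After time `T` it sinks, so that it stays below the
barrier `⟨ξ, x⟩ - (η + δ) t` wherever `σ * ‖perp e x‖ ≥ 3 * δ / 2 * T`, at all times. -/
noncomputable def roof (ξ e : 𝔼) (c lam σ δ η T : ℝ) (x : 𝔼) (t : ℝ) : ℝ :=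
  inner ℝ ξ x - lam * |inner ℝ e x - c| - σ * ‖perp e x‖ - η * t
    + min (δ / 2 * t) (3 * δ / 2 * T - δ * t)

section roof

variable {ξ e : EuclideanSpace ℝ (Fin d)} {c lam σ δ η T : ℝ}

/-- The derivatives of a test function touching the roof from above. Relative to `ξ`, the component of
its gradient along `e` is at most `lam` in absolute value, with equality off the
hyperplane, and the orthogonal component is small. -/
theorem derivs_of_touching_roof (he : ‖e‖ = 1) (hlam : 0 ≤ lam) (hσ : 0 ≤ σ) (hδ : 0 ≤ δ)
    {φ : 𝔼 × ℝ → ℝ} (hφ : ContDiff ℝ 1 φ) {x : 𝔼} {t : ℝ}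
    (hmax : IsLocalMax (fun z : 𝔼 × ℝ => roof ξ e c lam σ δ η T z.1 z.2 - φ z) (x, t)) :
    timeDeriv φ (x, t) ≤ -η + δ / 2 ∧ ∃ τ w, |τ| ≤ lam ∧ ‖w‖ ≤ σ ∧
      spaceGrad φ (x, t) = ξ + τ • e + w ∧ (inner ℝ e x ≠ c → |τ| = lam) := by
  have htime : timeDeriv φ (x, t) ≤ -η + δ / 2 := by
    have h1 := le_deriv_of_isLocalMax hφ (v := 0) (s := -1) (c := η - δ / 2) hmax (by
      filter_upwards [self_mem_nhdsWithin] with r (hr : 0 < r)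
      simp only [roof, smul_zero, add_zero]
      have : min (δ / 2 * t) (3 * δ / 2 * T - δ * t) - r * (δ / 2)
          ≤ min (δ / 2 * (t + r * -1)) (3 * δ / 2 * T - δ * (t + r * -1)) := by
        refine le_min ?_ ?_
        · linarith [min_le_left (δ / 2 * t) (3 * δ / 2 * T - δ * t)]
        · have : 0 ≤ δ * r := by positivity
          linarith [min_le_right (δ / 2 * t) (3 * δ / 2 * T - δ * t)]
      linarith)
    simp only [inner_zero_right, zero_add] at h1
    linarith
  refine ⟨htime, ?_⟩
  obtain ⟨p, hp⟩ : ∃ p, p = spaceGrad φ (x, t) - ξ := ⟨_, rfl⟩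
  have hpξ : spaceGrad φ (x, t) = ξ + p := by rw [hp]; abel
  have hline : ∀ (v : 𝔼) (m : ℝ), (∀ᶠ r in 𝓝[>] (0 : ℝ), roof ξ e c lam σ δ η T x t
      + r * (inner ℝ ξ v + m) ≤ roof ξ e c lam σ δ η T (x + r • v) t) → m ≤ inner ℝ p v := by
    intro v m hm
    have h1 := le_deriv_of_isLocalMax hφ (v := v) (s := 0) (c := inner ℝ ξ v + m) hmax
      (by simpa using hm)
    rw [hpξ, inner_add_left] at h1
    linarith
  have hdir : ∀ (κ m : ℝ), (∀ᶠ r in 𝓝[>] (0 : ℝ),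
      lam * |inner ℝ e x - c + r * κ| + r * m ≤ lam * |inner ℝ e x - c|) →
      m ≤ κ * inner ℝ p e := by
    intro κ m hm
    rw [← inner_smul_right]
    refine hline (κ • e) m ?_
    filter_upwards [hm] with r hr
    rw [smul_smul, roof, roof, perp_add_smul he, inner_add_right, inner_add_right,
      inner_smul_right, inner_smul_right, inner_smul_right, real_inner_self_eq_norm_sq, he]
    have : inner ℝ e x + r * κ * 1 ^ 2 - c = inner ℝ e x - c + r * κ := by ring
    rw [this]
    linarith
  have hτ : |inner ℝ e p| ≤ lam := by
    rw [real_inner_comm, abs_le]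
    have key : ∀ κ : ℝ, |κ| = 1 → -lam ≤ κ * inner ℝ p e := fun κ hκ => by
      refine hdir κ (-lam) ?_
      filter_upwards [self_mem_nhdsWithin] with r (hr : 0 < r)
      have h1 := abs_add_le (inner ℝ e x - c) (r * κ)
      rw [abs_mul, hκ, abs_of_pos hr, mul_one] at h1
      have := mul_le_mul_of_nonneg_left h1 hlam
      linarith
    constructor
    · linarith [key 1 (by simp)]
    · linarith [key (-1) (by simp)]
  refine ⟨inner ℝ e p, perp e p, hτ, ?_, ?_, fun hne => ?_⟩
  · have h1 : -(σ * ‖perp e p‖) ≤ inner ℝ p (-perp e p) := by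
      refine hline _ _ ?_
      filter_upwards [self_mem_nhdsWithin] with r (hr : 0 < r)
      have h2 : inner ℝ e (x + r • -perp e p) = inner ℝ e x := by
        rw [inner_add_right, inner_smul_right, inner_neg_right, inner_perp he]; ring
      have h3 : perp e (x + r • -perp e p) = perp e x - r • perp e p := by
        change x + r • -perp e p - (inner ℝ e (x + r • -perp e p) : ℝ) • e
          = x - (inner ℝ e x : ℝ) • e - r • perp e p
        rw [h2, smul_neg]; abel
      have h4 := norm_sub_le (perp e x) (r • perp e p)
      rw [norm_smul, Real.norm_of_nonneg hr.le] at h4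
      have h5 := mul_le_mul_of_nonneg_left h4 hσ
      rw [roof, roof, h2, h3, inner_add_right ξ, inner_smul_right]
      linarith
    have h6 : inner ℝ p (perp e p) = ‖perp e p‖ ^ 2 := by
      have h7 : p = perp e p + (inner ℝ e p : ℝ) • e := by rw [perp]; abel
      rw [← real_inner_self_eq_norm_sq]
      nth_rewrite 1 [h7]
      rw [inner_add_left, inner_smul_left, inner_perp he, mul_zero, add_zero]
    rw [inner_neg_right, h6] at h1
    rcases (norm_nonneg (perp e p)).eq_or_lt with h0 | h0
    · rw [← h0]; exact hσ
    · nlinarith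
  · rw [hpξ, perp]; abel
  · refine le_antisymm hτ ?_
    rw [real_inner_comm]
    rcases lt_or_gt_of_ne hne with hlt | hgt
    · have h1 := hdir 1 lam (by
        have : ∀ᶠ r in 𝓝[>] (0 : ℝ), r < c - inner ℝ e x :=
          (eventually_lt_nhds (by linarith)).filter_mono nhdsWithin_le_nhds
        filter_upwards [this] with r hr
        rw [abs_of_nonpos (by linarith), abs_of_nonpos (by linarith)]
        linarith)
      rw [one_mul] at h1
      exact h1.trans (le_abs_self _)
    · have h1 := hdir (-1) lam (by
        have : ∀ᶠ r in 𝓝[>] (0 : ℝ), r < inner ℝ e x - c :=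
          (eventually_lt_nhds (by linarith)).filter_mono nhdsWithin_le_nhds
        filter_upwards [this] with r hr
        rw [abs_of_nonneg (by linarith), abs_of_nonneg (by linarith)]
        linarith)
      linarith [neg_abs_le (inner ℝ p e)]

end roof

/-- If `W ≥ δ` on a large piece of the hyperplane `⟨e, x⟩ = c`, and `h` has a strict maximum at `ξ` in
the direction `e`, then supersolutions grow faster than at rate `-h ξ`: the roof over this piece,
completed by the trivial lower barrier, is a subsolution. -/
theorem growth_of_hyperplane {h W : 𝔼 → ℝ} (hh : Continuous h) {L : ℝ} (hL : 0 ≤ L)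
    (hWL : ∀ x y, |W x - W y| ≤ L * ‖x - y‖) {ξ e : 𝔼} (he : ‖e‖ = 1) {lam σ δ : ℝ}
    (hlam : 0 ≤ lam) (hσ : 0 ≤ σ) (hδ : 0 ≤ δ)
    (h1 : ∀ (τ : ℝ) (w : 𝔼), |τ| ≤ lam → ‖w‖ ≤ σ → h (ξ + τ • e + w) ≤ h ξ + δ / 2)
    (h2 : ∀ (τ : ℝ) (w : 𝔼), |τ| = lam → ‖w‖ ≤ σ → h (ξ + τ • e + w) ≤ h ξ - 3 * δ / 2)
    (hWδ : ∀ x, -δ ≤ W x) {c T : ℝ} (hT : 0 ≤ T)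
    (hplane : ∀ x, inner ℝ e x = c → σ * ‖perp e x‖ ≤ 3 * δ / 2 * T → δ ≤ W x)
    {u : 𝔼 → ℝ → ℝ} {C : ℝ} (hC : 0 ≤ C)
    (huc : ContinuousOn (fun z : 𝔼 × ℝ => u z.1 z.2) (Set.univ ×ˢ Set.Ici 0))
    (hu : ∀ x t, 0 ≤ t → inner ℝ ξ x - C * t ≤ u x t)
    (husup : IsViscositySupersolution (fun p x => h p - W x) u) :
    (-h ξ + δ / 2) * T - lam * |c| ≤ u 0 T := by
  set m : 𝔼 → ℝ → ℝ := fun x t =>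
    max (roof ξ e c lam σ δ (h ξ) T x t) (inner ℝ ξ x + -(h ξ + δ) * t) with hm
  have hmsub : IsViscositySubsolution (fun p x => h p - W x) m := by
    intro φ hφ x t ht hmax
    change timeDeriv φ (x, t) + (h (spaceGrad φ (x, t)) - W x) ≤ 0
    rcases le_or_gt (roof ξ e c lam σ δ (h ξ) T x t) (inner ℝ ξ x + -(h ξ + δ) * t) with hc | hc
    · obtain ⟨h3, h4⟩ := eq_affine_of_isLocalMax hφ hmax (max_eq_right hc)
        (Eventually.of_forall fun z => le_max_right _ _)
      rw [h3, h4]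
      linarith [hWδ x]
    · obtain ⟨h3, τ, w, hτ, hw, h4, h5⟩ := derivs_of_touching_roof (ξ := ξ) (c := c)
        (η := h ξ) (T := T) he hlam hσ hδ hφ (x := x) (t := t) (by
        filter_upwards [hmax] with z hz
        simp only [hm] at hz
        rw [max_eq_left hc.le] at hz
        linarith [le_max_left (roof ξ e c lam σ δ (h ξ) T z.1 z.2)
          (inner ℝ ξ z.1 + -(h ξ + δ) * z.2)])
      rw [h4]
      by_cases hx : inner ℝ e x = c
      · -- where the roof is above the barrier, the hyperplane carries high values
        have h6 : δ ≤ W x := by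
          refine hplane x hx ?_
          rw [roof, hx, sub_self, abs_zero, mul_zero] at hc
          linarith [min_le_right (δ / 2 * t) (3 * δ / 2 * T - δ * t)]
        linarith [h1 τ w hτ hw]
      · linarith [h2 τ w (h5 hx) hw, hWδ x]
  have hperpc : Continuous fun z : 𝔼 × ℝ => perp e z.1 := by unfold perp; fun_prop
  have hmc : ContinuousOn (fun z : 𝔼 × ℝ => m z.1 z.2) (Set.univ ×ˢ Set.Ici 0) := by
    simp only [hm, roof]
    fun_prop
  set C' : ℝ := max C (|h ξ| + δ) with hC'
  have hmle : ∀ x t, 0 ≤ t → m x t ≤ inner ℝ ξ x + C' * t := by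
    intro x t ht
    have h3 : (|h ξ| + δ) * t ≤ C' * t := mul_le_mul_of_nonneg_right (le_max_right _ _) ht
    have h4 : -|h ξ| * t ≤ h ξ * t := mul_le_mul_of_nonneg_right (neg_abs_le _) ht
    have h5 : 0 ≤ δ * t := by positivity
    refine max_le ?_ (by linarith)
    have h6 : 0 ≤ lam * |inner ℝ e x - c| := by positivity
    have h7 : 0 ≤ σ * ‖perp e x‖ := by positivity
    have h8 := min_le_left (δ / 2 * t) (3 * δ / 2 * T - δ * t)
    rw [roof]
    linarith
  have hule : ∀ x t, 0 ≤ t → inner ℝ ξ x - C' * t ≤ u x t := fun x t ht => by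
    have h3 : C * t ≤ C' * t := mul_le_mul_of_nonneg_right (le_max_left _ _) ht
    linarith [hu x t ht]
  have hmlip : ∀ x y t, 0 ≤ t → m x t - m y t ≤ (‖ξ‖ + lam + 2 * σ) * ‖x - y‖ := by
    intro x y t _
    have h3 : inner ℝ ξ x - inner ℝ ξ y ≤ ‖ξ‖ * ‖x - y‖ := by
      rw [← inner_sub_right]; exact real_inner_le_norm _ _
    have h4 : |inner ℝ e y - c| ≤ |inner ℝ e x - c| + ‖x - y‖ := by
      have h5 : |inner ℝ e (y - x)| ≤ ‖x - y‖ := by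
        simpa [he, norm_sub_rev] using abs_real_inner_le_norm e (y - x)
      have h6 := abs_add_le (inner ℝ e x - c) (inner ℝ e (y - x))
      rw [inner_sub_right] at h5 h6
      rw [show inner ℝ e x - c + (inner ℝ e y - inner ℝ e x) = inner ℝ e y - c by ring] at h6
      linarith
    have h5 : ‖perp e y‖ ≤ ‖perp e x‖ + 2 * ‖x - y‖ := by
      have h6 := norm_perp_le he (y - x)
      have h7 := norm_add_le (perp e x) (perp e (y - x))
      rw [perp_sub, add_sub_cancel, ← perp_sub] at h7
      rw [norm_sub_rev y x] at h6
      linarith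
    have h8 := mul_le_mul_of_nonneg_left h4 hlam
    have h9 := mul_le_mul_of_nonneg_left h5 hσ
    have h10 : 0 ≤ lam * ‖x - y‖ := by positivity
    have h11 : 0 ≤ σ * ‖x - y‖ := by positivity
    have h12 := le_max_left (roof ξ e c lam σ δ (h ξ) T y t) (inner ℝ ξ y + -(h ξ + δ) * t)
    have h13 := le_max_right (roof ξ e c lam σ δ (h ξ) T y t) (inner ℝ ξ y + -(h ξ + δ) * t)
    rw [sub_le_iff_le_add]
    refine max_le ?_ ?_
    · simp only [hm, roof] at h12 ⊢
      linarith
    · simp only [hm] at h13 ⊢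
      linarith
  have hcomp := comparison hh hL hWL (ξ := ξ) (C := C') (K := ‖ξ‖ + lam + 2 * σ)
    (hC.trans (le_max_left _ _)) (by positivity) hmc huc hmle hule hmsub husup (Or.inl hmlip) 0 hT
  have h3 : roof ξ e c lam σ δ (h ξ) T 0 T ≤ m 0 T := le_max_left _ _
  have h4 : roof ξ e c lam σ δ (h ξ) T 0 T = (-h ξ + δ / 2) * T - lam * |c| := by
    rw [roof, show 3 * δ / 2 * T - δ * T = δ / 2 * T by ring, min_self]
    simp [perp]
    ring
  linarith

/-- The counterpart of `growth_of_hyperplane` for subsolutions. -/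
theorem decay_of_hyperplane {h W : 𝔼 → ℝ} (hh : Continuous h) {L : ℝ} (hL : 0 ≤ L)
    (hWL : ∀ x y, |W x - W y| ≤ L * ‖x - y‖) {ξ e : 𝔼} (he : ‖e‖ = 1) {lam σ δ : ℝ}
    (hlam : 0 ≤ lam) (hσ : 0 ≤ σ) (hδ : 0 ≤ δ)
    (h1 : ∀ (τ : ℝ) (w : 𝔼), |τ| ≤ lam → ‖w‖ ≤ σ → h ξ - δ / 2 ≤ h (ξ + τ • e + w))
    (h2 : ∀ (τ : ℝ) (w : 𝔼), |τ| = lam → ‖w‖ ≤ σ → h ξ + 3 * δ / 2 ≤ h (ξ + τ • e + w))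
    (hWδ : ∀ x, W x ≤ δ) {c T : ℝ} (hT : 0 ≤ T)
    (hplane : ∀ x, inner ℝ e x = c → σ * ‖perp e x‖ ≤ 3 * δ / 2 * T → W x ≤ -δ)
    {u : 𝔼 → ℝ → ℝ} {C : ℝ} (hC : 0 ≤ C)
    (huc : ContinuousOn (fun z : 𝔼 × ℝ => u z.1 z.2) (Set.univ ×ˢ Set.Ici 0))
    (hu : ∀ x t, 0 ≤ t → u x t ≤ inner ℝ ξ x + C * t)
    (husub : IsViscositySubsolution (fun p x => h p - W x) u) :
    u 0 T ≤ (-h ξ - δ / 2) * T + lam * |c| := by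
  have hflip : ∀ (τ : ℝ) (w : 𝔼), -(-ξ + τ • e + w) = ξ + (-τ) • e + -w := fun τ w => by
    rw [neg_smul]; abel
  have key := growth_of_hyperplane (h := fun p => -h (-p)) (W := fun x => -W x) (ξ := -ξ) (e := e)
    (c := c) (u := fun x t => -u x t) (by fun_prop) hL
    (fun x y => by
      have := hWL x y
      rwa [← abs_neg, show -(-W x - -W y) = W x - W y by ring])
    he hlam hσ hδ
    (fun τ w hτ hw => by
      have := h1 (-τ) (-w) (by rwa [abs_neg]) (by rwa [norm_neg])
      rw [hflip, neg_neg]; linarith)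
    (fun τ w hτ hw => by
      have := h2 (-τ) (-w) (by rwa [abs_neg]) (by rwa [norm_neg])
      rw [hflip, neg_neg]; linarith)
    (fun x => by linarith [hWδ x]) hT (fun x hx hp => by linarith [hplane x hx hp]) hC huc.neg
    (fun x t ht => by rw [inner_neg_left]; linarith [hu x t ht])
    (by
      have := super_neg husub
      have he : (fun (p x : 𝔼) => -(h (-p) - W x)) = fun p x => -h (-p) - -W x := by
        funext p x; ring
      rwa [he] at this)
  simp only [neg_neg] at key
  linarith

/-- The quantities extracted from a strict saddle point: a direction `e` of strict maximum, a
direction `f` of strict minimum, a slope `lam`, an amplitude `δ` and a tolerance `σ`. -/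
theorem HasStrictSaddle.exists_constants {h : 𝔼 → ℝ} (hh : Continuous h) {ξ : 𝔼}
    (hs : HasStrictSaddle h ξ) : ∃ (e f : 𝔼) (lam σ δ : ℝ), ‖e‖ = 1 ∧ ‖f‖ = 1 ∧ 0 < lam ∧ 0 < σ ∧
      0 < δ ∧ δ ≤ 1 ∧ ∀ (τ : ℝ) (w : 𝔼), ‖w‖ ≤ σ →
        (|τ| ≤ lam → h (ξ + τ • e + w) ≤ h ξ + δ / 2 ∧ h ξ - δ / 2 ≤ h (ξ + τ • f + w)) ∧
        (|τ| = lam → h (ξ + τ • e + w) ≤ h ξ - 3 * δ / 2 ∧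
          h ξ + 3 * δ / 2 ≤ h (ξ + τ • f + w)) := by
  obtain ⟨P₁, P₂, hP₁, hP₂, -, -, η, hη, H⟩ := hs
  have hunit : ∀ P : Submodule ℝ 𝔼, P ≠ ⊥ → ∃ e ∈ P, ‖e‖ = 1 := by
    intro P hP
    obtain ⟨v, hv, hv0⟩ := Submodule.exists_mem_ne_zero_of_ne_bot hP
    exact ⟨(‖v‖)⁻¹ • v, P.smul_mem _ hv, norm_smul_inv_norm hv0⟩
  obtain ⟨e, heP, he⟩ := hunit P₁ hP₁
  obtain ⟨f, hfP, hf⟩ := hunit P₂ hP₂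
  obtain ⟨He, Hf⟩ := H e heP f hfP he hf
  have hηmem : η ∈ Set.Icc (-η) η \ {0} := ⟨⟨by linarith, le_rfl⟩, hη.ne'⟩
  have hηmem' : -η ∈ Set.Icc (-η) η \ {0} := ⟨⟨le_rfl, by linarith⟩, by simpa using hη.ne'⟩
  obtain ⟨δ, hδ0, hδ1, e1, e2, f1, f2⟩ : ∃ δ, 0 < δ ∧ δ ≤ 1 ∧ 2 * δ ≤ h ξ - h (ξ + η • e) ∧
      2 * δ ≤ h ξ - h (ξ + (-η) • e) ∧ 2 * δ ≤ h (ξ + η • f) - h ξ ∧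
      2 * δ ≤ h (ξ + (-η) • f) - h ξ := by
    have a1 := sub_pos.2 (He η hηmem)
    have a2 := sub_pos.2 (He (-η) hηmem')
    have a3 := sub_pos.2 (Hf η hηmem)
    have a4 := sub_pos.2 (Hf (-η) hηmem')
    have hpos := lt_min (lt_min a1 a2) (lt_min a3 a4)
    set μ := min (min (h ξ - h (ξ + η • e)) (h ξ - h (ξ + (-η) • e)))
      (min (h (ξ + η • f) - h ξ) (h (ξ + (-η) • f) - h ξ)) with hμ
    have hle : 2 * min 1 (μ / 2) ≤ μ := by linarith [min_le_right 1 (μ / 2)]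
    refine ⟨min 1 (μ / 2), by positivity, min_le_left _ _, hle.trans ?_, hle.trans ?_,
      hle.trans ?_, hle.trans ?_⟩
    · exact (min_le_left _ _).trans (min_le_left _ _)
    · exact (min_le_left _ _).trans (min_le_right _ _)
    · exact (min_le_right _ _).trans (min_le_left _ _)
    · exact (min_le_right _ _).trans (min_le_right _ _)
  obtain ⟨σ, hσ0, hσ⟩ : ∃ σ > 0, ∀ p w : 𝔼, ‖p - ξ‖ ≤ η → ‖w‖ ≤ σ → |h (p + w) - h p| < δ / 2 := by
    have huc := (isCompact_closedBall ξ (η + 1)).uniformContinuousOn_of_continuous hh.continuousOn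
    obtain ⟨r, hr, H⟩ := Metric.uniformContinuousOn_iff.1 huc (δ / 2) (by positivity)
    refine ⟨min 1 (r / 2), by positivity, fun p w hp hw => ?_⟩
    have h1 : ‖w‖ ≤ 1 := hw.trans (min_le_left _ _)
    have h2 : ‖w‖ ≤ r / 2 := hw.trans (min_le_right _ _)
    have h3 : ‖p + w - ξ‖ ≤ ‖p - ξ‖ + ‖w‖ := by
      rw [add_sub_right_comm]; exact norm_add_le _ _
    have := H (p + w) (by rw [mem_closedBall_iff_norm]; linarith) p
      (by rw [mem_closedBall_iff_norm]; linarith)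
      (by rw [dist_eq_norm, add_sub_cancel_left]; linarith)
    rwa [Real.dist_eq] at this
  have hmod : ∀ (g : 𝔼) (τ : ℝ) (w : 𝔼), ‖g‖ = 1 → |τ| ≤ η → ‖w‖ ≤ σ →
      |h (ξ + τ • g + w) - h (ξ + τ • g)| < δ / 2 := fun g τ w hg hτ hw => by
    refine hσ _ _ ?_ hw
    rw [add_sub_cancel_left, norm_smul, hg, mul_one, Real.norm_eq_abs]
    exact hτ
  refine ⟨e, f, η, σ, δ, he, hf, hη, hσ0, hδ0, hδ1, fun τ w hw => ⟨fun hτ => ?_, fun hτ => ?_⟩⟩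
  · have m1 := (abs_lt.1 (hmod e τ w he hτ hw)).2
    have m2 := (abs_lt.1 (hmod f τ w hf hτ hw)).1
    rcases eq_or_ne τ 0 with rfl | h0
    · rw [zero_smul, add_zero] at m1 m2 ⊢
      rw [zero_smul, add_zero]
      constructor <;> linarith
    · have hmem : τ ∈ Set.Icc (-η) η \ {0} := ⟨abs_le.1 hτ, h0⟩
      have := He τ hmem
      have := Hf τ hmem
      constructor <;> linarith
  · have m1 := (abs_lt.1 (hmod e τ w he hτ.le hw)).2
    have m2 := (abs_lt.1 (hmod f τ w hf hτ.le hw)).1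
    rcases eq_or_eq_neg_of_abs_eq hτ with rfl | rfl
    · constructor <;> linarith
    · constructor <;> linarith

end Viscosity

/-! ### Non-homogenization -/

namespace PlaneField

open Viscosity

variable {d : ℕ}

local notation "𝔼" => EuclideanSpace ℝ (Fin d)

/-- The random field of amplitude `δ`. -/
noncomputable def field (e f : 𝔼) (δ : ℝ) (x : 𝔼) (ω : Sample e f) : ℝ := δ * value (x +ᵥ ω)

theorem isStationaryErgodicField (e f : 𝔼) (δ : ℝ) :
    IsStationaryErgodicField (CharHull.haar (phase e f)) (field e f δ) where
  isProbabilityMeasure := inferInstance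
  measurable_vadd x := (continuous_const.add continuous_id).measurable
  ergodic := CharHull.ergodic (phase e f)
  measurable x := (measurable_value.comp (continuous_const.add continuous_id).measurable).const_mul δ
  stationary x ω := by rw [field, field, zero_vadd]

theorem field_mem {e f : 𝔼} {δ : ℝ} (hδ : 0 ≤ δ) (x : 𝔼) (ω : Sample e f) :
    field e f δ x ω ∈ Set.Icc (-δ) δ := by
  obtain ⟨h1, h2⟩ := value_mem (x +ᵥ ω)
  rw [field]
  constructor <;> nlinarith

theorem abs_field_sub_le {e f : 𝔼} (he : ‖e‖ = 1) (hf : ‖f‖ = 1) {δ : ℝ} (hδ : 0 ≤ δ)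
    (x y : 𝔼) (ω : Sample e f) : |field e f δ x ω - field e f δ y ω| ≤ 2 * δ * ‖x - y‖ := by
  rw [field, field, ← mul_sub, abs_mul, abs_of_nonneg hδ]
  have := mul_le_mul_of_nonneg_left (abs_value_vadd_sub_le he hf x y ω) hδ
  linarith

theorem lipschitzWith_field {e f : 𝔼} (he : ‖e‖ = 1) (hf : ‖f‖ = 1) {δ : ℝ} (hδ : 0 ≤ δ)
    (hδ1 : δ ≤ 1) (ω : Sample e f) : LipschitzWith 2 fun x => field e f δ x ω := by
  refine LipschitzWith.of_dist_le_mul fun x y => ?_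
  rw [Real.dist_eq, dist_eq_norm]
  refine (abs_field_sub_le he hf hδ x y ω).trans ?_
  have := norm_nonneg (x - y)
  push_cast
  nlinarith

/-- If arbitrarily large scales carry a hyperplane, close to the origin relative to the
scale, with a property `p` on a large piece, then after rescaling by `ε = t / scale` the
property is seen on a large piece of a hyperplane close to the origin. -/
theorem frequently_rescaled {g : ℕ → 𝔼} {s : ℕ → ℕ} (hs : StrictMono s) {e : 𝔼} (he : ‖e‖ = 1)
    (hg : ∀ k, g (s k) = e) {κ σ B t : ℝ} (ht : 0 < t) (hσ : 0 < σ)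
    {p : 𝔼 → Prop}
    (h : ∃ᶠ k in atTop, ∃ c : ℝ, |c| ≤ κ * scale (s k) ∧
      ∀ x : 𝔼, inner ℝ (g (s k)) x = c → ‖x‖ ≤ (κ + B / σ) * scale (s k) → p x) :
    ∃ᶠ ε in 𝓝[>] (0 : ℝ), 0 < ε ∧ ∃ c : ℝ, |c| ≤ κ * t ∧
      ∀ x : 𝔼, inner ℝ e x = c → σ * ‖perp e x‖ ≤ B * t → p (ε⁻¹ • x) := by
  have hlim : Tendsto (fun k => t / scale (s k)) atTop (𝓝[>] (0 : ℝ)) := by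
    refine tendsto_nhdsWithin_iff.2 ⟨?_, Eventually.of_forall fun k => div_pos ht (scale_pos _)⟩
    exact tendsto_const_nhds.div_atTop (tendsto_scale.comp hs.tendsto_atTop)
  refine hlim.frequently (h.mono ?_)
  rintro k ⟨c, hc, hp⟩
  rw [hg] at hp
  have hR := scale_pos (s k)
  obtain ⟨R, hRdef⟩ : ∃ R, R = scale (s k) := ⟨_, rfl⟩
  rw [← hRdef] at hc hp hR ⊢
  have hε : 0 < t / R := div_pos ht hR
  refine ⟨hε, t / R * c, ?_, fun x hx hxp => hp _ ?_ ?_⟩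
  · rw [abs_mul, abs_of_pos hε, div_mul_eq_mul_div, div_le_iff₀ hR]
    have := mul_le_mul_of_nonneg_left hc ht.le
    linarith
  · rw [inner_smul_right, hx, inv_mul_cancel_left₀ hε.ne']
  · have h1 := norm_le_abs_inner_add_norm_perp he x
    have h2 : ‖perp e x‖ ≤ B / σ * t := by
      rw [div_mul_eq_mul_div, le_div_iff₀ hσ]; linarith
    have h3 : |inner ℝ e x| ≤ κ * t := by
      rw [hx, abs_mul, abs_of_pos hε, div_mul_eq_mul_div, div_le_iff₀ hR]
      have := mul_le_mul_of_nonneg_left hc ht.le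
      linarith
    have h4 : ‖x‖ ≤ (κ + B / σ) * t := by linarith
    rw [norm_smul, norm_inv, Real.norm_of_nonneg hε.le, inv_div, div_mul_eq_mul_div,
      div_le_iff₀ ht]
    have := mul_le_mul_of_nonneg_left h4 hR.le
    linarith

end PlaneField

theorem theorem1p1 {d : ℕ} (h : EuclideanSpace ℝ (Fin d) → ℝ) (h_cont : Continuous h)
    (h_coercive : IsCoerciveHamiltonian h) (ξ₀ : EuclideanSpace ℝ (Fin d))
    (h_saddle : HasStrictSaddle h ξ₀) :
    ∃ (Ω : Type) (_ : MeasurableSpace Ω) (_ : AddAction (EuclideanSpace ℝ (Fin d)) Ω)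
      (P : Measure Ω) (V : EuclideanSpace ℝ (Fin d) → Ω → ℝ),
      IsStationaryErgodicField P V ∧
      (∀ ω, (∀ x, V x ω ∈ Set.Icc (-1 : ℝ) 1) ∧ LipschitzWith 2 (fun x => V x ω)) ∧
      ∀ᵐ ω ∂P, ∃ u : ℝ → EuclideanSpace ℝ (Fin d) → ℝ → ℝ,
        (∀ ε : ℝ, 0 < ε →
          IsTheViscositySolution (fun ξ x => h ξ - V (ε⁻¹ • x) ω) ξ₀ (u ε)) ∧
        ∀ t : ℝ, 0 < t →
          liminf (fun ε : ℝ => ((u ε 0 t : ℝ) : EReal)) (𝓝[>] 0) <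
            limsup (fun ε : ℝ => ((u ε 0 t : ℝ) : EReal)) (𝓝[>] 0) := by
  open PlaneField Viscosity in
  obtain ⟨e, f, lam, σ, δ, he, hf, hlam, hσ, hδ, hδ1, hsad⟩ :=
    Viscosity.HasStrictSaddle.exists_constants h_cont h_saddle
  have hmem1 : ∀ x (ω : Sample e f), field e f δ x ω ∈ Set.Icc (-1 : ℝ) 1 := fun x ω =>
    ⟨by linarith [(field_mem hδ.le x ω).1], by linarith [(field_mem hδ.le x ω).2]⟩
  refine ⟨Sample e f, inferInstance, inferInstance, CharHull.haar (phase e f), field e f δ,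
    isStationaryErgodicField e f δ,
    fun ω => ⟨fun x => hmem1 x ω, lipschitzWith_field he hf hδ.le hδ1 ω⟩, ?_⟩
  -- `κ` makes the cost of reaching a hyperplane at most half of the gain `δ / 2 * t`
  obtain ⟨κ, hκ0, hκ⟩ : ∃ κ, 0 < κ ∧ lam * κ = δ / 4 := ⟨δ / (4 * lam), by positivity, by field_simp⟩
  have heven : StrictMono fun k : ℕ => 2 * k := fun a b hab => by dsimp only; omega
  have hodd : StrictMono fun k : ℕ => 2 * k + 1 := fun a b hab => by dsimp only; omega
  have hdire : ∀ k : ℕ, dir e f (2 * k) = e := fun k => if_pos (even_two_mul k)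
  have hnot : ∀ k : ℕ, ¬ Even (2 * k + 1) := fun k => by
    rw [Nat.not_even_iff_odd]; exact odd_two_mul_add_one k
  have hdirf : ∀ k : ℕ, dir e f (2 * k + 1) = f := fun k => if_neg (hnot k)
  filter_upwards [ae_frequently_isolated_plane he hf heven hκ0 (κ + 3 * δ / 2 / σ),
    ae_frequently_isolated_plane he hf hodd hκ0 (κ + 3 * δ / 2 / σ)] with ω hω1 hω2
  have hWL : ∀ {ε : ℝ}, 0 < ε → ∀ x y : EuclideanSpace ℝ (Fin d),
      |field e f δ (ε⁻¹ • x) ω - field e f δ (ε⁻¹ • y) ω| ≤ 2 * δ * ε⁻¹ * ‖x - y‖ := by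
    intro ε hε x y
    have := abs_field_sub_le he hf hδ.le (ε⁻¹ • x) (ε⁻¹ • y) ω
    rwa [← smul_sub, norm_smul, Real.norm_of_nonneg (by positivity), ← mul_assoc] at this
  have hex : ∀ ε : ℝ, ∃ u, 0 < ε →
      IsTheViscositySolution (fun ξ x => h ξ - field e f δ (ε⁻¹ • x) ω) ξ₀ u := by
    intro ε
    by_cases hε : 0 < ε
    · obtain ⟨u, hu⟩ := exists_isTheViscositySolution (W := fun x => field e f δ (ε⁻¹ • x) ω) h_cont
        h_coercive (by positivity) (hWL hε) (fun x => abs_le.2 (hmem1 _ ω)) ξ₀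
      exact ⟨u, fun _ => hu⟩
    · exact ⟨fun _ _ => 0, fun h0 => absurd h0 hε⟩
  choose u hu using hex
  refine ⟨u, hu, fun t ht => ?_⟩
  obtain ⟨C, hC0, hC⟩ : ∃ C, 0 ≤ C ∧ ∀ p, ‖p - ξ₀‖ ≤ 1 → |h p| + 1 ≤ C :=
    exists_bound_near h_cont ξ₀
  have hhigh : ∃ᶠ ε in 𝓝[>] (0 : ℝ), (-h ξ₀ + δ / 4) * t ≤ u ε 0 t := by
    refine (frequently_rescaled (g := dir e f) heven he hdire (κ := κ) (B := 3 * δ / 2)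
      (p := fun x => field e f δ x ω = δ) ht hσ (hω1.mono ?_)).mono ?_
    · rintro k ⟨c, hc, hp⟩
      refine ⟨c, hc, fun x hx hxn => ?_⟩
      obtain ⟨h1, h2⟩ := hp x hx hxn
      rw [field, value_eq_one (even_two_mul k) h1 fun m hm _ => h2 m hm, mul_one]
    · rintro ε ⟨hε, c, hc, hp⟩
      obtain ⟨hsol, -⟩ := hu ε hε
      have h1 := growth_of_hyperplane (W := fun x => field e f δ (ε⁻¹ • x) ω) h_cont
        (L := 2 * δ * ε⁻¹) (by positivity) (hWL hε) he hlam.le hσ.le hδ.le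
        (fun τ w hτ hw => ((hsad τ w hw).1 hτ).1) (fun τ w hτ hw => ((hsad τ w hw).2 hτ).1)
        (fun x => (field_mem hδ.le _ ω).1) (c := c) ht.le
        (fun x hx hxp => (hp x hx hxp).ge) hC0 hsol.continuousOn
        (fun x t ht => hsol.le_of_bound hC (fun x => hmem1 _ ω) x ht) hsol.super
      have h2 := mul_le_mul_of_nonneg_left hc hlam.le
      rw [← mul_assoc, hκ] at h2
      linarith
  have hlow : ∃ᶠ ε in 𝓝[>] (0 : ℝ), u ε 0 t ≤ (-h ξ₀ - δ / 4) * t := by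
    refine (frequently_rescaled (g := dir e f) hodd hf hdirf (κ := κ) (B := 3 * δ / 2)
      (p := fun x => field e f δ x ω = -δ) ht hσ (hω2.mono ?_)).mono ?_
    · rintro k ⟨c, hc, hp⟩
      refine ⟨c, hc, fun x hx hxn => ?_⟩
      obtain ⟨h1, h2⟩ := hp x hx hxn
      rw [field, value_eq_neg_one (hnot k) h1 fun m hm _ => h2 m hm, mul_neg_one]
    · rintro ε ⟨hε, c, hc, hp⟩
      obtain ⟨hsol, -⟩ := hu ε hε
      have h1 := decay_of_hyperplane (W := fun x => field e f δ (ε⁻¹ • x) ω) h_cont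
        (L := 2 * δ * ε⁻¹) (by positivity) (hWL hε) hf hlam.le hσ.le hδ.le
        (fun τ w hτ hw => ((hsad τ w hw).1 hτ).2) (fun τ w hτ hw => ((hsad τ w hw).2 hτ).2)
        (fun x => (field_mem hδ.le _ ω).2) (c := c) ht.le
        (fun x hx hxp => (hp x hx hxp).le) hC0 hsol.continuousOn
        (fun x t ht => hsol.le_bound hC (fun x => hmem1 _ ω) x ht) hsol.sub
      have h2 := mul_le_mul_of_nonneg_left hc hlam.le
      rw [← mul_assoc, hκ] at h2
      linarith
  have hgap : (-h ξ₀ - δ / 4) * t < (-h ξ₀ + δ / 4) * t :=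
    mul_lt_mul_of_pos_right (by linarith) ht
  calc liminf (fun ε : ℝ => ((u ε 0 t : ℝ) : EReal)) (𝓝[>] 0)
      ≤ (((-h ξ₀ - δ / 4) * t : ℝ) : EReal) :=
        liminf_le_of_frequently_le' (hlow.mono fun ε hε => EReal.coe_le_coe_iff.2 hε)
    _ < (((-h ξ₀ + δ / 4) * t : ℝ) : EReal) := EReal.coe_lt_coe_iff.2 hgap
    _ ≤ limsup (fun ε : ℝ => ((u ε 0 t : ℝ) : EReal)) (𝓝[>] 0) :=
        le_limsup_of_frequently_le' (hhigh.mono fun ε hε => EReal.coe_le_coe_iff.2 hε)
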